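/- There is a universal constant $C>0$ with the following property. Let $d\ge 1$, let $f_X$ be a probability density on $\mathbb{R}^d$ with $\int \|y\| f_X(y)\,dy<\infty$, and for every $N\ge 1$ let $x(1),\dots,x(N)$ be drawn independently from $f_X$. Let $E(i)=\frac1N\sum_{j=1}^N\|x(i)-x(j)\|$ be the energy of element $i$, let $x(m^*)$ be the medoid (an element of least energy, with any fixed choice in case of ties), and $E^*=E(m^*)$. Suppose that there are constants $\rho,\delta_0,\delta_1,\alpha>0$, independent of $N$, such that (1) with probability $1-O(1/N)$: $\delta_0\le f_X(y)\le\delta_1$ for all $y\in\mathbb{R}^d$ with $\|y-x(m^*)\|\le\rho$; (2) with probability $1-O(1/N)$: $E(i)-E^*\ge\alpha\|x(i)-x(m^*)\|^2$ for all $i\in\{1,\dots,N\}$ with $N^{-1/(2d)}\le\|x(i)-x(m^*)\|\le\rho$. Consider the algorithm trimed: start with lower bounds $l(j)=0$ for all $j$ and $E^{cl}=\infty$; go through the indices $i$ in a uniformly random order (independent of the points); if $l(i)<E^{cl}$, then $i$ is *computed*: all distances $\|x(i)-x(j)\|$ are evaluated, $l(i)$ is set to $E(i)$, the current best index and its energy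 $E^{cl}$ are replaced by $i$ and $E(i)$ if $E(i)<E^{cl}$, and then each $l(j)$ is replaced by $\max(l(j),|E(i)-\|x(i)-x(j)\||)$; if $l(i)\ge E^{cl}$, then $i$ is skipped; at the end return the current best index. Then there is $N_0$ (which may depend on $d$, $f_X$ and all the constants) such that for all $N\ge N_0$ the expected number of elements computed by trimed is at most $$C\left(V_d[1]\,\delta_1+d\left(\tfrac{4}{\alpha}\right)^d\right)N^{1/2},\qquad V_d[1]=\frac{\pi^{d/2}}{\Gamma(\frac d2+1)},$$ and its expected run time, counting each evaluation of a distance, arithmetic operation or comparison of real numbers, and store as one step, is at most $C\left(V_d[1]\,\delta_1+d\left(\tfrac{4}{\alpha}\right)^d\right)N^{3/2}$. -/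

import Mathlib

open MeasureTheory
open scoped ENNReal

noncomputable section

/-- The mean distance from the `i`-th element to the elements of the set, itself included. -/
def energy {E : Type*} [Dist E] {N : ℕ} (x : Fin N → E) (i : Fin N) : ℝ :=
  (∑ j, dist (x i) (x j)) / N

/-- `x m` is a medoid of `x 0, …, x (N - 1)`: an element of the set with least energy. -/
def IsMedoid {E : Type*} [Dist E] {N : ℕ} (x : Fin N → E) (m : Fin N) : Prop :=
  ∀ j, energy x m ≤ energy x j

/-- The variables of the algorithm trimed on `N` elements, with two counters that the algorithm
itself never reads. -/
structure TrimedState (N : ℕ) where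
  /-- lower bounds on the energies -/
  l : Fin N → ℝ
  /-- index of the best medoid candidate so far (`none` before the first one) -/
  mcl : Option (Fin N)
  /-- the energy of that candidate (`⊤` before the first one) -/
  Ecl : WithTop ℝ
  /-- the elements computed so far, that is those which passed the bound test -/
  computed : Finset (Fin N)
  /-- elementary steps so far: evaluations of a distance, arithmetic operations and comparisons
  of real numbers, and stores, each at unit cost -/
  time : ℕ

/-- Initialisation: `N` stores for `l`, two for `mcl` and `Ecl`, and `N` steps to shuffle the
indices. -/
def trimedInit (N : ℕ) : TrimedState N where
  l := fun _ => 0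
  mcl := none
  Ecl := ⊤
  computed := ∅
  time := N + 2 + N

/-- What is done with an element `i` that passes the bound test: all distances `D j` to it are
evaluated, its lower bound is set to its energy `e`, the best candidate is updated if `e` improves
on it, and the lower bounds of all elements are improved by the triangle inequality. -/
def trimedCompute {E : Type*} [Dist E] {N : ℕ} (x : Fin N → E) (s : TrimedState N) (i : Fin N) :
    TrimedState N :=
  let D : Fin N → ℝ := fun j => dist (x i) (x j)
  let e : ℝ := (∑ j, D j) / N
  let l' : Fin N → ℝ := Function.update s.l i e
  { l := fun j => max (l' j) |e - D j|
    mcl := if (e : WithTop ℝ) < s.Ecl then some i else s.mcl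
    Ecl := if (e : WithTop ℝ) < s.Ecl then (e : WithTop ℝ) else s.Ecl
    computed := insert i s.computed
    time := s.time
      + 2 * N -- evaluate and store the distances
      + (N + 1) -- sum them up, divide, store the mean
      + 1 -- compare with the best energy
      + (if (e : WithTop ℝ) < s.Ecl then 2 else 0) -- store the new candidate and its energy
      + 4 * N } -- subtraction, absolute value, maximum and store for every bound

/-- One pass of the main loop, for the element `i`: the bound test (one step), and the computation
of `i` if its lower bound is less than the best energy so far. -/
def trimedStep {E : Type*} [Dist E] {N : ℕ} (x : Fin N → E) (s : TrimedState N) (i : Fin N) :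
    TrimedState N :=
  if (s.l i : WithTop ℝ) < s.Ecl then
    trimedCompute x { s with time := s.time + 1 } i
  else
    { s with time := s.time + 1 }

/-- The run of trimed on `x` when the shuffle puts the indices in the order
`σ 0, σ 1, …, σ (N - 1)`. -/
def trimed {E : Type*} [Dist E] {N : ℕ} (x : Fin N → E) (σ : Equiv.Perm (Fin N)) :
    TrimedState N :=
  ((List.finRange N).map σ).foldl (trimedStep x) (trimedInit N)

/-- The number of elements computed by trimed. -/
def numComputed {E : Type*} [Dist E] {N : ℕ} (x : Fin N → E) (σ : Equiv.Perm (Fin N)) : ℕ :=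
  (trimed x σ).computed.card

/-- The run time of trimed: the steps up to the end of the main loop, and three more to store the
index and the energy of the medoid and to return it. -/
def runTime {E : Type*} [Dist E] {N : ℕ} (x : Fin N → E) (σ : Equiv.Perm (Fin N)) : ℕ :=
  (trimed x σ).time + 3

/-- The law of `N` independent points with density `f` in `ℝ^d`. -/
def sampleLaw {d : ℕ} (f : EuclideanSpace ℝ (Fin d) → ℝ) (N : ℕ) :
    Measure (Fin N → EuclideanSpace ℝ (Fin d)) :=
  Measure.pi fun _ => volume.withDensity fun y => ENNReal.ofReal (f y)

/-- The expectation of a quantity `T x σ`, where `x` consists of `N` independent points with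
density `f`, and the order `σ` is uniformly random and independent of `x`. -/
def expectedValue {d : ℕ} (f : EuclideanSpace ℝ (Fin d) → ℝ) (N : ℕ)
    (T : (Fin N → EuclideanSpace ℝ (Fin d)) → Equiv.Perm (Fin N) → ℕ) : ℝ≥0∞ :=
  ∫⁻ x, (∑ σ, (T x σ : ℝ≥0∞)) / (Fintype.card (Equiv.Perm (Fin N)) : ℝ≥0∞) ∂(sampleLaw f N)

/-- The volume of the unit ball of `ℝ^d`. -/
def unitBallVolume (d : ℕ) : ℝ :=
  Real.pi ^ ((d : ℝ) / 2) / Real.Gamma ((d : ℝ) / 2 + 1)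

end

/-! The lower bounds kept by the algorithm are valid by the triangle inequality. Hence, if `i` and
later `j` are computed, `|E(i) - ‖x(i) - x(j)‖| < E(k)` for every `k` visited before `j`. If an
element of energy at most `E(i) - s` precedes `i`, all elements computed after `i` are farther than
`s` from `x(i)` (`energy_sub_lt_dist_of_computed`). Such computed elements are separated, and
comparing volumes bounds their number (`card_computed_le_of_gap`).

Quadratic growth allows `s` of order `α w²` at distance `w` from the medoid, so a shell `[w, 2w]`
contributes at most `6 (4/α)^d w^(-d)` elements. The dyadic shells between `r = N^(-1/(2d))` and `ρ`
add up to `12 (4/α)^d N^(1/2)`, and the ball of radius `r` holds about `3 V δ₁ N^(1/2)` points at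
most. Beyond `ρ`, convexity of the mean distance turns quadratic growth into linear growth
(`linear_growth_of_quadratic_growth`). Each shell there contributes a bounded number, and the finite
first moment leaves few shells.

There remain elements visited before any reference of low enough energy. In a random order an
element precedes all of a set `S` with probability at most `1/#S`
(`card_perm_forall_lt_mul_card_le`), so many good references are needed. Points close to the medoid
qualify because the mean distance is nearly flat there (`meanDist_le_of_dense_axes`): it is convex
with small second differences, and sample points on the opposite side of the medoid cannot have less
energy than the medoid. With two sets of references, a small one used only for elements near the
medoid and a larger one for the rest, this part is `O(N^(19/40))`.

The argument needs balls around the medoid to hold roughly the expected number of points. The medoid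
is a random index, so Chernoff bounds are proved around every sample point and combined by a union
bound. The exceptional event has probability `O(1/N)` and at most `N` elements are computed on it,
so it costs `O(1)`. A computed element takes `O(N)` steps, which gives the run time. -/

/-! ### The run of trimed -/

/-- The mean distance from `y` to the elements of the set. -/
noncomputable def meanDist {E : Type*} [Dist E] {N : ℕ} (x : Fin N → E) (y : E) : ℝ :=
  (∑ j, dist y (x j)) / N

theorem energy_eq_meanDist {E : Type*} [Dist E] {N : ℕ} (x : Fin N → E) (i : Fin N) :
    energy x i = meanDist x (x i) := rfl

theorem meanDist_le_add_dist {E : Type*} [PseudoMetricSpace E] {N : ℕ} (x : Fin N → E) (y z : E) :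
    meanDist x y ≤ meanDist x z + dist y z := by
  rcases Nat.eq_zero_or_pos N with rfl | hN
  · simp [meanDist]
  have hN' : (0 : ℝ) < N := by exact_mod_cast hN
  unfold meanDist
  rw [div_add' _ _ _ hN'.ne', div_le_div_iff_of_pos_right hN']
  calc ∑ j, dist y (x j) ≤ ∑ j, (dist z (x j) + dist y z) :=
        Finset.sum_le_sum fun j _ => by linarith [dist_triangle y z (x j)]
    _ = _ := by simp [Finset.sum_add_distrib, mul_comm]

theorem dist_le_energy_add_energy {E : Type*} [PseudoMetricSpace E] {N : ℕ} (x : Fin N → E)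
    (i j : Fin N) : dist (x i) (x j) ≤ energy x i + energy x j := by
  have hN' : (0 : ℝ) < N := by exact_mod_cast i.pos
  unfold energy
  rw [← add_div, le_div_iff₀ hN', ← Finset.sum_add_distrib]
  calc dist (x i) (x j) * N = ∑ _k : Fin N, dist (x i) (x j) := by simp [mul_comm]
    _ ≤ _ := Finset.sum_le_sum fun k _ => dist_triangle_right _ _ _

/-- Soundness of the update of the bounds. One sign is the 1-Lipschitz property of the mean
distance, the other is the triangle inequality through `x k`, averaged over `k`. -/
theorem abs_energy_sub_dist_le {E : Type*} [PseudoMetricSpace E] {N : ℕ} (x : Fin N → E)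
    (i j : Fin N) : |energy x i - dist (x i) (x j)| ≤ energy x j := by
  have h1 := meanDist_le_add_dist x (x i) (x j)
  have h2 := dist_le_energy_add_energy x i j
  simp only [← energy_eq_meanDist] at h1
  rw [abs_le]; constructor <;> linarith

/-- What holds after trimed has visited the elements in the positions `0, …, n - 1`, where `p i`
is the position of the element `i`. -/
structure TrimedInvariant {E : Type*} [Dist E] {N : ℕ} (x : Fin N → E) (p : Fin N → ℕ) (n : ℕ)
    (s : TrimedState N) : Prop where
  l_le : ∀ j, s.l j ≤ energy x j
  Ecl_le : ∀ k, p k < n → s.Ecl ≤ (energy x k : WithTop ℝ)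
  lt_of_computed : ∀ i ∈ s.computed, p i < n
  le_l : ∀ i ∈ s.computed, ∀ j, |energy x i - dist (x i) (x j)| ≤ s.l j
  lt_energy : ∀ i ∈ s.computed, ∀ j ∈ s.computed, p i < p j → ∀ k, p k < p j →
    |energy x i - dist (x i) (x j)| < energy x k
  time_le : s.time ≤ 2 * N + 2 + n + s.computed.card * (7 * N + 4)

theorem trimedInvariant_init {E : Type*} [PseudoMetricSpace E] {N : ℕ} (x : Fin N → E)
    (p : Fin N → ℕ) : TrimedInvariant x p 0 (trimedInit N) where
  l_le j := by
    simp only [trimedInit, energy]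
    positivity
  Ecl_le k hk := by omega
  lt_of_computed i hi := by simp [trimedInit] at hi
  le_l i hi := by simp [trimedInit] at hi
  lt_energy i hi := by simp [trimedInit] at hi
  time_le := by simp [trimedInit]; omega

theorem TrimedInvariant.step {E : Type*} [PseudoMetricSpace E] {N : ℕ} {x : Fin N → E}
    {p : Fin N → ℕ} (hp : Function.Injective p) {s : TrimedState N} (e : Fin N)
    (h : TrimedInvariant x p (p e) s) : TrimedInvariant x p (p e + 1) (trimedStep x s e) := by
  unfold trimedStep
  split_ifs with hlt
  · have hEe : (∑ j, dist (x e) (x j)) / N = energy x e := rfl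
    have hl : ∀ j, Function.update s.l e (energy x e) j ≤ energy x j := by
      intro j
      rcases eq_or_ne j e with rfl | hne
      · simp
      · simpa [hne] using h.l_le j
    have hl' : ∀ j, s.l j ≤ Function.update s.l e (energy x e) j := by
      intro j
      rcases eq_or_ne j e with rfl | hne
      · simpa using h.l_le j
      · simp [hne]
    have hnot : e ∉ s.computed := fun he => lt_irrefl _ (h.lt_of_computed e he)
    refine ⟨?_, ?_, ?_, ?_, ?_, ?_⟩
    · intro j
      simp only [trimedCompute, hEe]
      exact max_le (hl j) (abs_energy_sub_dist_le x e j)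
    · intro k hk
      simp only [trimedCompute, hEe]
      have key : p k < p e ∨ k = e := by
        rcases Nat.lt_succ_iff_lt_or_eq.1 hk with h1 | h1
        · exact Or.inl h1
        · exact Or.inr (hp h1)
      split_ifs with h2
      · rcases key with h1 | rfl
        · exact h2.le.trans (h.Ecl_le k h1)
        · exact le_rfl
      · rcases key with h1 | rfl
        · exact h.Ecl_le k h1
        · exact not_lt.1 h2
    · intro i hi
      simp only [trimedCompute, Finset.mem_insert] at hi
      rcases hi with rfl | hi
      · exact Nat.lt_succ_self _
      · exact (h.lt_of_computed i hi).trans (Nat.lt_succ_self _)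
    · intro i hi j
      simp only [trimedCompute, Finset.mem_insert, hEe] at hi ⊢
      rcases hi with rfl | hi
      · exact le_max_right _ _
      · exact ((h.le_l i hi j).trans (hl' j)).trans (le_max_left _ _)
    · intro i hi j hj hij k hk
      simp only [trimedCompute, Finset.mem_insert] at hi hj
      rcases hj with rfl | hj
      · rcases hi with rfl | hi
        · exact absurd hij (lt_irrefl _)
        -- The heart of the invariant: the bound left by `i` is at most `l j`, which passed the test
        -- against `Ecl`, and `Ecl` is at most the energy of anything visited.
        · have h1 := (WithTop.coe_le_coe.2 (h.le_l i hi j)).trans_lt (hlt.trans_le (h.Ecl_le k hk))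
          exact WithTop.coe_lt_coe.1 h1
      · rcases hi with rfl | hi
        · exact absurd hij (h.lt_of_computed j hj).not_gt
        · exact h.lt_energy i hi j hj hij k hk
    · have ht := h.time_le
      simp only [trimedCompute, Finset.card_insert_of_notMem hnot, add_mul, one_mul]
      split_ifs <;> omega
  · refine ⟨h.l_le, ?_, ?_, h.le_l, h.lt_energy, ?_⟩
    · intro k hk
      rcases Nat.lt_succ_iff_lt_or_eq.1 hk with h1 | h1
      · exact h.Ecl_le k h1
      · obtain rfl := hp h1
        -- A skipped element has `Ecl ≤ l k ≤ energy x k`, so `Ecl` is a minimum over all visited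
        -- elements, not only the computed ones.
        exact (not_lt.1 hlt).trans (WithTop.coe_le_coe.2 (h.l_le k))
    · intro i hi
      exact (h.lt_of_computed i hi).trans (Nat.lt_succ_self _)
    · have ht := h.time_le
      simp only
      omega

theorem trimedInvariant_trimed {E : Type*} [PseudoMetricSpace E] {N : ℕ} (x : Fin N → E)
    (σ : Equiv.Perm (Fin N)) :
    TrimedInvariant x (fun i => (σ.symm i : ℕ)) N (trimed x σ) := by
  have hp : Function.Injective fun i => (σ.symm i : ℕ) :=
    fun i j hij => σ.symm.injective (Fin.ext hij)
  have key : ∀ n ≤ N, TrimedInvariant x (fun i => (σ.symm i : ℕ)) n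
      ((((List.finRange N).map σ).take n).foldl (trimedStep x) (trimedInit N)) := by
    intro n
    induction n with
    | zero => intro _; simpa using trimedInvariant_init x _
    | succ n ih =>
      intro hn
      have hlen : n < ((List.finRange N).map σ).length := by simpa using hn
      rw [← List.take_append_getElem hlen, List.foldl_append]
      have h := ih (by omega)
      have he : (σ.symm (((List.finRange N).map σ)[n]) : ℕ) = n := by simp
      simp only [List.foldl_cons, List.foldl_nil]
      have h2 := TrimedInvariant.step hp (((List.finRange N).map σ)[n]) (by
        simp only [he]; exact h)
      simpa only [he] using h2
  have h := key N le_rfl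
  rwa [List.take_of_length_le (by simp)] at h

/-- An element computed after `i` has been neither eliminated by `i` nor by an element visited
earlier. -/
theorem abs_energy_sub_dist_lt_of_computed {E : Type*} [PseudoMetricSpace E] {N : ℕ}
    {x : Fin N → E} {σ : Equiv.Perm (Fin N)} {i j k : Fin N} (hi : i ∈ (trimed x σ).computed)
    (hj : j ∈ (trimed x σ).computed) (hij : σ.symm i < σ.symm j) (hkj : σ.symm k < σ.symm j) :
    |energy x i - dist (x i) (x j)| < energy x k :=
  (trimedInvariant_trimed x σ).lt_energy i hi j hj hij k hkj

theorem runTime_le {E : Type*} [PseudoMetricSpace E] {N : ℕ} (x : Fin N → E)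
    (σ : Equiv.Perm (Fin N)) :
    runTime x σ ≤ 3 * N + 5 + numComputed x σ * (7 * N + 4) := by
  have := (trimedInvariant_trimed x σ).time_le
  unfold runTime numComputed
  omega

theorem numComputed_le {E : Type*} [Dist E] {N : ℕ} (x : Fin N → E)
    (σ : Equiv.Perm (Fin N)) : numComputed x σ ≤ N := by
  unfold numComputed
  simpa using (trimed x σ).computed.card_le_univ

/-! ### Random orders -/

/-- The fraction of orders in which `i` precedes all other elements of `S` is at most `1 / #S`. -/
theorem card_perm_forall_lt_mul_card_le {N : ℕ} (i : Fin N) (S : Finset (Fin N)) :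
    (Finset.univ.filter fun σ : Equiv.Perm (Fin N) =>
      ∀ k ∈ S, k ≠ i → σ.symm i < σ.symm k).card * S.card ≤ N.factorial := by
  classical
  set T := insert i S
  have hiT : i ∈ T := Finset.mem_insert_self _ _
  let F : Fin N → Finset (Equiv.Perm (Fin N)) := fun a =>
    Finset.univ.filter fun σ => ∀ k ∈ T, k ≠ a → σ.symm a < σ.symm k
  have hF : (Finset.univ.filter fun σ : Equiv.Perm (Fin N) =>
      ∀ k ∈ S, k ≠ i → σ.symm i < σ.symm k) = F i := by
    refine Finset.filter_congr fun σ _ => ?_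
    constructor
    · intro h k hk hki
      exact h k ((Finset.mem_insert.1 hk).resolve_left hki) hki
    · intro h k hk hki
      exact h k (Finset.mem_insert_of_mem hk) hki
  have hcard : ∀ a ∈ T, (F i).card ≤ (F a).card := by
    intro a ha
    -- Exchanging the labels `i` and `a` turns orders in which `i` is first in `T` into orders in
    -- which `a` is first. The classes `F a` are disjoint, so each is a fraction of at most `1 /
    -- #T`.
    refine Finset.card_le_card_of_injOn (fun σ => Equiv.swap i a * σ) ?_ ?_
    · intro σ hσ
      simp only [F, Finset.coe_filter, Finset.mem_univ, true_and, Set.mem_ofPred_eq] at hσ ⊢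
      intro k hk hka
      have e : ∀ b, (Equiv.swap i a * σ).symm b = σ.symm (Equiv.swap i a b) := by
        intro b
        rw [Equiv.symm_apply_eq]
        simp
      rw [e, e, Equiv.swap_apply_right]
      refine hσ _ ?_ ?_
      · rcases eq_or_ne k i with rfl | hki
        · simpa using ha
        · rwa [Equiv.swap_apply_of_ne_of_ne hki hka]
      · intro h
        have := congrArg (Equiv.swap i a) h
        simp at this
        exact hka this
    · intro σ _ τ _ h
      exact mul_left_cancel h
  have hdisj : (T : Set (Fin N)).PairwiseDisjoint F := by
    intro a ha b hb hab
    refine Finset.disjoint_left.2 fun σ h1 h2 => ?_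
    simp only [F, Finset.mem_filter, Finset.mem_univ, true_and] at h1 h2
    exact lt_asymm (h1 b hb hab.symm) (h2 a ha hab)
  calc _ ≤ (F i).card * T.card := by
        rw [hF]; exact Nat.mul_le_mul_left _ (Finset.card_le_card (Finset.subset_insert _ _))
    _ = ∑ _a ∈ T, (F i).card := by simp [mul_comm]
    _ ≤ ∑ a ∈ T, (F a).card := Finset.sum_le_sum hcard
    _ = (T.biUnion F).card := (Finset.card_biUnion hdisj).symm
    _ ≤ (Finset.univ : Finset (Equiv.Perm (Fin N))).card := Finset.card_le_univ _
    _ = N.factorial := by simp [Fintype.card_perm]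

/-! ### Packing -/

/-- At most `(1 + 2 R / s) ^ n` points of a ball of radius `R` have mutual distances at least
`s`. -/
theorem card_le_of_separated_of_dist_le {E : Type*} [NormedAddCommGroup E] [NormedSpace ℝ E]
    [FiniteDimensional ℝ E] {ι : Type*} (x : ι → E) (G : Finset ι) (c : E) {R s : ℝ} (hs : 0 < s)
    (hR : 0 ≤ R) (hG : ∀ i ∈ G, dist (x i) c ≤ R)
    (hsep : ∀ i ∈ G, ∀ j ∈ G, i ≠ j → s ≤ dist (x i) (x j)) :
    (G.card : ℝ) ≤ (1 + 2 * R / s) ^ Module.finrank ℝ E := by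
  borelize E
  let μ : Measure E := Measure.addHaar
  have hδ : 0 < s / 2 := by positivity
  have hρ : 0 < R + s / 2 := by positivity
  have D : (G : Set ι).Pairwise (Function.onFun Disjoint fun i => Metric.ball (x i) (s / 2)) := by
    intro i hi j hj hij
    apply Metric.ball_disjoint_ball
    linarith [hsep i hi j hj hij]
  have A_subset : (⋃ i ∈ G, Metric.ball (x i) (s / 2)) ⊆ Metric.ball c (R + s / 2) := by
    refine Set.iUnion₂_subset fun i hi => ?_
    apply Metric.ball_subset_ball'
    linarith [hG i hi]
  have I : (G.card : ℝ≥0∞) * ENNReal.ofReal ((s / 2) ^ Module.finrank ℝ E) * μ (Metric.ball 0 1) ≤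
      ENNReal.ofReal ((R + s / 2) ^ Module.finrank ℝ E) * μ (Metric.ball 0 1) :=
    calc
      _ = μ (⋃ i ∈ G, Metric.ball (x i) (s / 2)) := by
        rw [measure_biUnion_finset D fun c _ => measurableSet_ball]
        simp only [μ.addHaar_ball_of_pos _ hδ]
        simp only [Finset.sum_const, nsmul_eq_mul, mul_assoc]
      _ ≤ μ (Metric.ball c (R + s / 2)) := measure_mono A_subset
      _ = _ := by simp only [μ.addHaar_ball_of_pos _ hρ]
  have J := (ENNReal.mul_le_mul_iff_left (Metric.measure_ball_pos μ _ zero_lt_one).ne'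
    measure_ball_lt_top.ne).1 I
  have K := ENNReal.toReal_le_of_le_ofReal (pow_nonneg hρ.le _) J
  rw [ENNReal.toReal_mul, ENNReal.toReal_natCast, ENNReal.toReal_ofReal (by positivity)] at K
  have hq : 1 + 2 * R / s = (R + s / 2) / (s / 2) := by field_simp; ring
  rw [hq, div_pow, le_div_iff₀ (by positivity)]
  exact K

/-! ### Dyadic shells -/

/-- The shells are closed on both sides and may overlap; only an upper bound is wanted. -/
theorem card_le_sum_card_shell {ι : Type*} (G : Finset ι) (w : ι → ℝ) {r : ℝ} (hr : 0 < r)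
    (K : ℕ) (hG : ∀ i ∈ G, r ≤ w i ∧ w i < 2 ^ K * r) :
    G.card ≤ ∑ k ∈ Finset.range K,
      (G.filter fun i => 2 ^ k * r ≤ w i ∧ w i ≤ 2 * (2 ^ k * r)).card := by
  classical
  refine le_trans (Finset.card_le_card ?_) Finset.card_biUnion_le
  intro i hi
  obtain ⟨h1, h2⟩ := hG i hi
  obtain ⟨k, hk1, hk2⟩ := exists_nat_pow_near (one_le_div hr |>.2 h1) one_lt_two
  rw [le_div_iff₀ hr] at hk1
  rw [div_lt_iff₀ hr] at hk2
  have hkK : k < K := by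
    by_contra! h
    have : (2 : ℝ) ^ K ≤ 2 ^ k := pow_le_pow_right₀ one_le_two h
    nlinarith
  simp only [Finset.mem_biUnion, Finset.mem_range, Finset.mem_filter]
  exact ⟨k, hkK, hi, hk1, by rw [pow_succ] at hk2; linarith⟩

/-- If a shell `[w₀, 2 w₀]` holds at most `M * w₀⁻¹ ^ d` elements, then there are at most
`2 * M * r⁻¹ ^ d` elements from `r` on. -/
theorem card_le_of_card_shell_le_pow {ι : Type*} (G : Finset ι) (w : ι → ℝ) {r M : ℝ} (hr : 0 < r)
    (hM : 0 ≤ M) {d : ℕ} (hd : 0 < d) (hG : ∀ i ∈ G, r ≤ w i)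
    (hshell : ∀ w₀, r ≤ w₀ → ∀ G' ⊆ G, (∀ i ∈ G', w₀ ≤ w i ∧ w i ≤ 2 * w₀) →
      (G'.card : ℝ) ≤ M * w₀⁻¹ ^ d) :
    (G.card : ℝ) ≤ 2 * M * r⁻¹ ^ d := by
  classical
  obtain ⟨K, hK⟩ : ∃ K : ℕ, ∀ i ∈ G, w i < 2 ^ K * r := by
    obtain ⟨B, hB⟩ := (G.image w).bddAbove
    obtain ⟨K, hK⟩ := pow_unbounded_of_one_lt (B / r) (one_lt_two (α := ℝ))
    refine ⟨K, fun i hi => ?_⟩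
    rw [div_lt_iff₀ hr] at hK
    exact (hB (by simpa using ⟨i, hi, rfl⟩)).trans_lt hK
  have h := card_le_sum_card_shell G w hr K fun i hi => ⟨hG i hi, hK i hi⟩
  calc (G.card : ℝ) ≤ ∑ k ∈ Finset.range K,
        ((G.filter fun i => 2 ^ k * r ≤ w i ∧ w i ≤ 2 * (2 ^ k * r)).card : ℝ) := by
        exact_mod_cast h
    _ ≤ ∑ k ∈ Finset.range K, (M * r⁻¹ ^ d) * (1 / 2 : ℝ) ^ k := by
        refine Finset.sum_le_sum fun k _ => ?_
        have h1 : r ≤ 2 ^ k * r := le_mul_of_one_le_left hr.le (one_le_pow₀ one_le_two)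
        refine (hshell (2 ^ k * r) h1 _ (Finset.filter_subset _ _) fun i hi =>
          (Finset.mem_filter.1 hi).2).trans ?_
        rw [mul_assoc]
        refine mul_le_mul_of_nonneg_left ?_ hM
        rw [mul_inv, mul_pow, mul_comm]
        refine mul_le_mul_of_nonneg_left ?_ (by positivity)
        rw [← inv_pow, ← one_div]
        -- The shell bounds decay with ratio `2^(-d) ≤ 1/2`, so the smallest shell dominates and the
        -- geometric sum costs only a factor `2` in any dimension.
        exact pow_le_of_le_one (by positivity) (pow_le_one₀ (by norm_num) (by norm_num)) hd.ne'
    _ = (M * r⁻¹ ^ d) * ∑ k ∈ Finset.range K, (1 / 2 : ℝ) ^ k := by rw [Finset.mul_sum]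
    _ ≤ (M * r⁻¹ ^ d) * 2 := by
        refine mul_le_mul_of_nonneg_left (sum_geometric_two_le K) (by positivity)
    _ = _ := by ring

theorem card_le_of_card_shell_le {ι : Type*} (G : Finset ι) (w : ι → ℝ) {r M : ℝ} (hr : 0 < r)
    (K : ℕ) (hG : ∀ i ∈ G, r ≤ w i ∧ w i < 2 ^ K * r)
    (hshell : ∀ w₀, r ≤ w₀ → ∀ G' ⊆ G, (∀ i ∈ G', w₀ ≤ w i ∧ w i ≤ 2 * w₀) →
      (G'.card : ℝ) ≤ M) :
    (G.card : ℝ) ≤ K * M := by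
  calc (G.card : ℝ) ≤ ∑ k ∈ Finset.range K,
        ((G.filter fun i => 2 ^ k * r ≤ w i ∧ w i ≤ 2 * (2 ^ k * r)).card : ℝ) := by
        exact_mod_cast card_le_sum_card_shell G w hr K hG
    _ ≤ ∑ k ∈ Finset.range K, M := by
        refine Finset.sum_le_sum fun k _ => ?_
        have h1 : r ≤ 2 ^ k * r := le_mul_of_one_le_left hr.le (one_le_pow₀ one_le_two)
        exact hshell (2 ^ k * r) h1 _ (Finset.filter_subset _ _) fun i hi =>
          (Finset.mem_filter.1 hi).2
    _ = _ := by simp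

/-! ### The mean distance as a convex function -/

theorem convexOn_meanDist {E : Type*} [NormedAddCommGroup E] [NormedSpace ℝ E] {N : ℕ}
    (x : Fin N → E) : ConvexOn ℝ Set.univ (meanDist x) := by
  refine ⟨convex_univ, fun y _ z _ a b ha hb hab => ?_⟩
  unfold meanDist
  rw [smul_eq_mul, smul_eq_mul, ← mul_div_assoc, ← mul_div_assoc, ← add_div]
  refine div_le_div_of_nonneg_right ?_ (Nat.cast_nonneg N)
  rw [Finset.mul_sum, Finset.mul_sum, ← Finset.sum_add_distrib]
  refine Finset.sum_le_sum fun j _ => ?_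
  have h := (convexOn_dist (x j) convex_univ).2 (Set.mem_univ y) (Set.mem_univ z) ha hb hab
  simpa using h

/-- By the parallelogram law the square of the left side is at most `4‖a‖² + 4‖v‖²`, which the
square of the right side exceeds by `(‖v‖²/‖a‖)²`. Thus the norm has second differences of order
`‖v‖²/‖a‖` away from the origin. -/
theorem norm_add_add_norm_sub_le_div {E : Type*} [NormedAddCommGroup E] [InnerProductSpace ℝ E]
    (a v : E) (ha : a ≠ 0) : ‖a + v‖ + ‖a - v‖ ≤ 2 * ‖a‖ + ‖v‖ ^ 2 / ‖a‖ := by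
  have ha' : 0 < ‖a‖ := norm_pos_iff.2 ha
  have hpar := parallelogram_law_with_norm ℝ a v
  have h0 : 0 ≤ 2 * ‖a‖ + ‖v‖ ^ 2 / ‖a‖ := by positivity
  refine abs_le_of_sq_le_sq' ?_ h0 |>.2
  have h1 : (2 * ‖a‖ + ‖v‖ ^ 2 / ‖a‖) ^ 2
      = 4 * ‖a‖ ^ 2 + 4 * ‖v‖ ^ 2 + (‖v‖ ^ 2 / ‖a‖) ^ 2 := by
    field_simp
    ring
  nlinarith [sq_nonneg (‖a + v‖ - ‖a - v‖), sq_nonneg (‖v‖ ^ 2 / ‖a‖)]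

/-- Points farther than `t` from `c` contribute a quadratic second difference. The few points within
`t` are bounded trivially by `2‖v‖`. -/
theorem meanDist_add_add_meanDist_sub_le {E : Type*} [NormedAddCommGroup E]
    [InnerProductSpace ℝ E] {N : ℕ} (x : Fin N → E) (c v : E) {t : ℝ} (ht : 0 < t) :
    meanDist x (c + v) + meanDist x (c - v) ≤ 2 * meanDist x c +
      2 * ‖v‖ * ((Finset.univ.filter fun j => dist (x j) c ≤ t).card / N) + ‖v‖ ^ 2 / t := by
  rcases Nat.eq_zero_or_pos N with rfl | hN
  · simp [meanDist]; positivity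
  have hN' : (0 : ℝ) < N := by exact_mod_cast hN
  have key : ∀ j, dist (c + v) (x j) + dist (c - v) (x j) ≤ 2 * dist c (x j) +
      ((if dist (x j) c ≤ t then 2 * ‖v‖ else 0) + ‖v‖ ^ 2 / t) := by
    intro j
    have e1 : dist (c + v) (x j) = ‖(c - x j) + v‖ := by rw [dist_eq_norm]; congr 1; abel
    have e2 : dist (c - v) (x j) = ‖(c - x j) - v‖ := by rw [dist_eq_norm]; congr 1; abel
    rw [e1, e2, dist_comm (x j) c, dist_eq_norm c (x j)]
    split_ifs with h
    · have h1 := norm_add_le (c - x j) v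
      have h2 := norm_sub_le (c - x j) v
      have : 0 ≤ ‖v‖ ^ 2 / t := by positivity
      linarith
    · push Not at h
      have h1 := norm_add_add_norm_sub_le_div (c - x j) v (norm_pos_iff.1 (ht.trans h))
      have : ‖v‖ ^ 2 / ‖c - x j‖ ≤ ‖v‖ ^ 2 / t := by gcongr
      linarith
  have hsum := Finset.sum_le_sum fun j (_ : j ∈ Finset.univ) => key j
  rw [Finset.sum_add_distrib, Finset.sum_add_distrib, Finset.sum_add_distrib, ← Finset.mul_sum,
    ← Finset.sum_filter] at hsum
  simp only [Finset.sum_const, nsmul_eq_mul, Finset.card_univ, Fintype.card_fin] at hsum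
  unfold meanDist
  rw [← add_div, div_le_iff₀ hN']
  refine hsum.trans (le_of_eq ?_)
  field_simp
  ring

/-- Near a point `c` of least mean distance among the elements, with an element close to `c - v`,
the mean distance is flat. -/
theorem meanDist_add_le_of_isLeast {E : Type*} [NormedAddCommGroup E]
    [InnerProductSpace ℝ E] {N : ℕ} (x : Fin N → E) (c v : E) {t κ : ℝ} (ht : 0 < t)
    (hc : ∀ k, meanDist x c ≤ meanDist x (x k)) (hκ : ∃ k, dist (x k) (c - v) ≤ κ) :
    meanDist x (c + v) ≤ meanDist x c +
      2 * ‖v‖ * ((Finset.univ.filter fun j => dist (x j) c ≤ t).card / N) + ‖v‖ ^ 2 / t + κ := by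
  obtain ⟨k, hk⟩ := hκ
  have h1 := meanDist_add_add_meanDist_sub_le x c v ht
  have h2 := meanDist_le_add_dist x (x k) (c - v)
  linarith [hc k]

theorem ConvexOn.le_add_mul_of_le_add {E : Type*} [NormedAddCommGroup E] [NormedSpace ℝ E]
    {g : E → ℝ} (hg : ConvexOn ℝ Set.univ g) (c u : E) {b a : ℝ} (ha : 0 ≤ a) (ha1 : a ≤ 1)
    (h : g (c + u) ≤ g c + b) : g (c + a • u) ≤ g c + a * b := by
  have h1 := hg.2 (Set.mem_univ c) (Set.mem_univ (c + u)) (sub_nonneg.2 ha1) ha (by ring)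
  have e : (1 - a) • c + a • (c + u) = c + a • u := by
    rw [smul_add, ← add_assoc, ← add_smul]; simp
  rw [e, smul_eq_mul, smul_eq_mul] at h1
  nlinarith

/-- A convex function whose slopes at `c` along the coordinate axes are at most `ε` at the
scale `s` has all slopes at `c` at most `d * ε` at the scale `s / d`. -/
theorem ConvexOn.le_add_norm_of_axes {d : ℕ} {g : EuclideanSpace ℝ (Fin d) → ℝ}
    (hg : ConvexOn ℝ Set.univ g) (c : EuclideanSpace ℝ (Fin d)) {s ε : ℝ} (hs : 0 < s)
    (hε : 0 ≤ ε) (hd : 0 < d)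
    (haxes : ∀ k, ∀ b : ℝ, |b| = s → g (c + EuclideanSpace.single k b) ≤ g c + s * ε)
    (v : EuclideanSpace ℝ (Fin d)) (hv : ‖v‖ ≤ s / d) :
    g (c + v) ≤ g c + d * ε * ‖v‖ := by
  have hd' : (0 : ℝ) < d := by exact_mod_cast hd
  have hvk : ∀ k, |v k| ≤ ‖v‖ := fun k => by
    simpa using PiLp.norm_apply_le v k
  have hk : ∀ k, g (c + EuclideanSpace.single k (d * v k)) ≤ g c + d * ‖v‖ * ε := by
    intro k
    set a : ℝ := d * |v k| / s with ha
    have ha0 : 0 ≤ a := by positivity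
    have ha1 : a ≤ 1 := by
      rw [ha, div_le_one hs]
      calc d * |v k| ≤ d * (s / d) := by gcongr; exact (hvk k).trans hv
        _ = s := by field_simp
    obtain ⟨b, hb, hbv⟩ : ∃ b : ℝ, |b| = s ∧ d * v k = a * b := by
      rcases le_total 0 (v k) with h | h
      · refine ⟨s, abs_of_pos hs, ?_⟩
        rw [ha, abs_of_nonneg h]; field_simp
      · refine ⟨-s, by rw [abs_neg, abs_of_pos hs], ?_⟩
        rw [ha, abs_of_nonpos h]; field_simp
    have h1 := hg.le_add_mul_of_le_add c (EuclideanSpace.single k b) ha0 ha1 (haxes k b hb)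
    have e : a • EuclideanSpace.single k b = EuclideanSpace.single k (d * v k) := by
      rw [hbv]; ext j
      simp
    rw [e] at h1
    refine h1.trans ?_
    have : a * (s * ε) = d * |v k| * ε := by rw [ha]; field_simp
    rw [this]
    gcongr
    exact hvk k
  have hw : ∑ _k : Fin d, (1 / d : ℝ) = 1 := by simp; field_simp
  have hJ := hg.map_sum_le (t := Finset.univ) (w := fun _ : Fin d => (1 / d : ℝ))
    (p := fun k => c + EuclideanSpace.single k (d * v k)) (fun _ _ => by positivity) hw
    (fun _ _ => Set.mem_univ _)
  -- Jensen's inequality is applied to `c + v` as the mean of `d` points on the axes through `c`.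
  -- The coordinates are stretched by `d`, hence the smaller scale `s / d` and the slope `d * ε`.
  have e : ∑ k : Fin d, (1 / d : ℝ) • (c + EuclideanSpace.single k (d * v k)) = c + v := by
    simp only [smul_add, Finset.sum_add_distrib]
    congr 1
    · rw [← Finset.sum_smul, hw, one_smul]
    · ext j
      simp [Pi.single_apply]
      field_simp
  rw [e] at hJ
  refine hJ.trans ?_
  calc ∑ k : Fin d, (1 / d : ℝ) • g (c + EuclideanSpace.single k (d * v k))
      ≤ ∑ k : Fin d, (1 / d : ℝ) • (g c + d * ‖v‖ * ε) := by
        refine Finset.sum_le_sum fun k _ => ?_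
        rw [smul_eq_mul, smul_eq_mul]
        exact mul_le_mul_of_nonneg_left (hk k) (by positivity)
    _ = _ := by rw [← Finset.sum_smul, hw, one_smul]; ring

/-- Quadratic growth of the energy up to the distance `ρ` of the medoid gives linear growth from
there on, if the elements are dense enough on the sphere of radius `ρ / 2`. -/
theorem linear_growth_of_quadratic_growth {E : Type*} [NormedAddCommGroup E] [NormedSpace ℝ E]
    {N : ℕ} (x : Fin N → E) (c : E) {ρ α κ r : ℝ} (hρ : 0 < ρ) (hα : 0 < α) (hr : r ≤ ρ / 4)
    (hκ : κ ≤ ρ / 4) (hκ' : κ ≤ α * ρ ^ 2 / 32)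
    (hgrowth : ∀ i, dist (x i) c ≤ ρ → r ≤ dist (x i) c →
      α * dist (x i) c ^ 2 ≤ meanDist x (x i) - meanDist x c)
    (hdense : ∀ u : E, ‖u‖ = ρ / 2 → ∃ k, dist (x k) (c + u) ≤ κ) (z : E) (hz : ρ ≤ dist z c) :
    α * ρ / 16 * dist z c ≤ meanDist x z - meanDist x c := by
  have hW : 0 < dist z c := hρ.trans_le hz
  set a : ℝ := ρ / (2 * dist z c) with ha
  have ha0 : 0 < a := by positivity
  have ha1 : a ≤ 1 := by rw [ha, div_le_one (by positivity)]; linarith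
  have hu : ‖a • (z - c)‖ = ρ / 2 := by
    rw [norm_smul, Real.norm_of_nonneg ha0.le, ← dist_eq_norm, ha]
    field_simp
  obtain ⟨k, hk⟩ := hdense _ hu
  have hcu : dist (c + a • (z - c)) c = ρ / 2 := by
    rw [dist_eq_norm]; simpa using hu
  have h1 : dist (x k) c ≤ κ + ρ / 2 := by
    linarith [dist_triangle (x k) (c + a • (z - c)) c]
  have h2 : ρ / 2 - κ ≤ dist (x k) c := by
    linarith [dist_triangle_left (c + a • (z - c)) c (x k)]
  have h3 := hgrowth k (by linarith) (by linarith)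
  have h4 := meanDist_le_add_dist x (x k) (c + a • (z - c))
  have h5 := (convexOn_meanDist x).le_add_mul_of_le_add c (z - c) (b := meanDist x z - meanDist x c)
    ha0.le ha1 (by simp)
  have h6 : α * (ρ / 4) ^ 2 ≤ α * dist (x k) c ^ 2 := by
    gcongr; linarith
  -- The point of the segment at distance `ρ / 2` from `c` has a sample point within `κ`, at
  -- distance at least `ρ / 4` from `c`. This gives excess `α ρ² / 16`, and passing back to the
  -- segment loses at most half of it.
  have h7 : α * ρ ^ 2 / 32 ≤ a * (meanDist x z - meanDist x c) := by nlinarith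
  calc α * ρ / 16 * dist z c = α * ρ ^ 2 / 32 / a := by rw [ha]; field_simp; norm_num
    _ ≤ _ := by rw [div_le_iff₀ ha0]; linarith

/-! ### Counting the computed elements for a fixed set -/

/-- If an element of energy at most `e` precedes `i`, then `i` eliminates all elements within the
distance `energy x i - e`. -/
theorem energy_sub_lt_dist_of_computed {E : Type*} [PseudoMetricSpace E] {N : ℕ}
    {x : Fin N → E} {σ : Equiv.Perm (Fin N)} {i j : Fin N} {e : ℝ}
    (hi : i ∈ (trimed x σ).computed) (hj : j ∈ (trimed x σ).computed)
    (hij : σ.symm i < σ.symm j) (hk : ∃ k, σ.symm k < σ.symm i ∧ energy x k ≤ e) :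
    energy x i - e < dist (x i) (x j) := by
  obtain ⟨k, hk1, hk2⟩ := hk
  have h := abs_energy_sub_dist_lt_of_computed hi hj hij (hk1.trans hij)
  linarith [(abs_lt.1 h).2]

/-- A packing bound for computed elements in a ball, each of which is preceded by an element whose
energy is lower by at least `s`. -/
theorem card_computed_le_of_gap {E : Type*} [NormedAddCommGroup E] [NormedSpace ℝ E]
    [FiniteDimensional ℝ E] {N : ℕ} (x : Fin N → E) (σ : Equiv.Perm (Fin N)) (c : E)
    (G : Finset (Fin N)) {R s : ℝ} (hs : 0 < s) (hR : 0 ≤ R)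
    (hG : ∀ i ∈ G, i ∈ (trimed x σ).computed ∧ dist (x i) c ≤ R ∧
      ∃ k, σ.symm k < σ.symm i ∧ energy x k ≤ energy x i - s) :
    (G.card : ℝ) ≤ (1 + 2 * R / s) ^ Module.finrank ℝ E := by
  refine card_le_of_separated_of_dist_le x G c hs hR (fun i hi => (hG i hi).2.1) ?_
  intro i hi j hj hij
  obtain ⟨hi1, -, hi3⟩ := hG i hi
  obtain ⟨hj1, -, hj3⟩ := hG j hj
  rcases lt_or_gt_of_ne (σ.symm.injective.ne hij) with h | h
  · linarith [energy_sub_lt_dist_of_computed hi1 hj1 h hi3]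
  · rw [dist_comm]
    linarith [energy_sub_lt_dist_of_computed hj1 hi1 h hj3]

/-- The packing bound for one shell, without exponential loss in `d` beyond `(4/α)^d`. Reserving
only the fraction `1/(2d)` of the growth for the reference costs `(1 - 1/(2d))^(-d) ≤ 2` by
Bernoulli's inequality. The term `1` costs at most `e ≤ 3`, which is what `α ρ d ≤ 4` is for. -/
theorem one_add_pow_le {d : ℕ} (hd : 0 < d) {α ρ w : ℝ} (hα : 0 < α) (hw : 0 < w) (hwρ : w ≤ ρ)
    (hρ : α * ρ * d ≤ 4) :
    (1 + 2 * (2 * w) / ((1 - 1 / (2 * d)) * (α * w ^ 2))) ^ d ≤ 6 * (4 / α) ^ d * w⁻¹ ^ d := by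
  have hd' : (1 : ℝ) ≤ d := by exact_mod_cast hd
  set q : ℝ := 1 - 1 / (2 * d) with hq
  have hq2 : 1 / (2 * d : ℝ) ≤ 1 / 2 := by
    apply one_div_le_one_div_of_le <;> linarith
  have hq0 : 0 < q := by rw [hq]; linarith
  have hq1 : q ≤ 1 := by
    have : 0 ≤ 1 / (2 * d : ℝ) := by positivity
    rw [hq]; linarith
  have hqd : 1 / 2 ≤ q ^ d := by
    have h := one_add_mul_le_pow (a := -(1 / (2 * d : ℝ))) (by linarith) d
    have e : 1 + (d : ℝ) * -(1 / (2 * d : ℝ)) = 1 / 2 := by field_simp; norm_num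
    rw [e] at h
    rw [hq, sub_eq_add_neg]; exact h
  have hexp : (1 + q * α * w / 4) ^ d ≤ 3 := by
    have h1 : 1 + q * α * w / 4 ≤ Real.exp (1 / d) := by
      refine le_trans ?_ (Real.add_one_le_exp _)
      have : q * α * w / 4 ≤ 1 / d := by
        rw [div_le_div_iff₀ (by norm_num) (by linarith)]
        calc q * α * w * d = q * (α * w * d) := by ring
          _ ≤ 1 * (α * ρ * d) := by gcongr
          _ ≤ 1 * 4 := by linarith
      linarith
    calc (1 + q * α * w / 4) ^ d ≤ Real.exp (1 / d) ^ d := by gcongr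
      _ = Real.exp 1 := by rw [← Real.exp_nat_mul]; congr 1; field_simp
      _ ≤ 3 := by linarith [Real.exp_one_lt_d9]
  have e : 1 + 2 * (2 * w) / (q * (α * w ^ 2)) = (1 + q * α * w / 4) * (4 / α) * w⁻¹ * q⁻¹ := by
    field_simp; ring
  rw [e, mul_pow, mul_pow, mul_pow]
  have hqi : q⁻¹ ^ d ≤ 2 := by
    rw [inv_pow]
    exact inv_le_of_inv_le₀ (by norm_num) (by rw [← one_div]; exact hqd)
  calc _ ≤ 3 * (4 / α) ^ d * w⁻¹ ^ d * 2 := by gcongr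
    _ = _ := by ring

theorem card_computed_near_le {d : ℕ} (hd : 0 < d) {N : ℕ} (x : Fin N → EuclideanSpace ℝ (Fin d))
    (σ : Equiv.Perm (Fin N)) (m : Fin N) {α ρ r : ℝ} (hα : 0 < α) (hr : 0 < r)
    (hρ : α * ρ * d ≤ 4)
    (hgrowth : ∀ i, dist (x i) (x m) ≤ ρ → r ≤ dist (x i) (x m) →
      α * dist (x i) (x m) ^ 2 ≤ energy x i - energy x m)
    (G : Finset (Fin N))
    (hG : ∀ i ∈ G, i ∈ (trimed x σ).computed ∧ r ≤ dist (x i) (x m) ∧ dist (x i) (x m) ≤ ρ ∧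
      ∃ k, σ.symm k < σ.symm i ∧
        energy x k ≤ energy x m + α / (2 * d) * dist (x i) (x m) ^ 2) :
    (G.card : ℝ) ≤ 12 * (4 / α) ^ d * r⁻¹ ^ d := by
  have hd' : (1 : ℝ) ≤ d := by exact_mod_cast hd
  have hq0 : 0 < 1 - 1 / (2 * d : ℝ) := by
    have : 1 / (2 * d : ℝ) ≤ 1 / 2 := by apply one_div_le_one_div_of_le <;> linarith
    linarith
  have h := card_le_of_card_shell_le_pow G (fun i => dist (x i) (x m)) hr
    (M := 6 * (4 / α) ^ d) (by positivity) hd (fun i hi => (hG i hi).2.1) ?_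
  · linarith
  intro w hw G' hG' hw'
  have hw0 : 0 < w := hr.trans_le hw
  rcases G'.eq_empty_or_nonempty with rfl | ⟨i₀, hi₀⟩
  · simp; positivity
  have hwρ : w ≤ ρ := (hw' i₀ hi₀).1.trans (hG i₀ (hG' hi₀)).2.2.1
  refine le_trans ?_ (one_add_pow_le hd hα hw0 hwρ hρ)
  have h := card_computed_le_of_gap x σ (x m) G' (R := 2 * w)
    (s := (1 - 1 / (2 * d)) * (α * w ^ 2)) (by positivity) (by positivity) ?_
  · simpa using h
  intro i hi
  obtain ⟨h1, h2, h3, k, hk, hke⟩ := hG i (hG' hi)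
  refine ⟨h1, (hw' i hi).2, k, hk, hke.trans ?_⟩
  have h4 := hgrowth i h3 h2
  have h5 : (1 - 1 / (2 * d)) * (α * w ^ 2) ≤
      (1 - 1 / (2 * d)) * (α * dist (x i) (x m) ^ 2) := by
    have := (hw' i hi).1
    gcongr
  have h6 : α / (2 * d) * dist (x i) (x m) ^ 2 = 1 / (2 * d) * (α * dist (x i) (x m) ^ 2) := by
    ring
  linarith

/-- Under linear growth the gap is proportional to the radius of the shell, so the packing bound is
the same in all `K` shells. -/
theorem card_computed_far_le {d : ℕ} {N : ℕ} (x : Fin N → EuclideanSpace ℝ (Fin d))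
    (σ : Equiv.Perm (Fin N)) (m : Fin N) {β ρ : ℝ} (hβ : 0 < β) (hρ : 0 < ρ) (K : ℕ)
    (hgrowth : ∀ i, ρ ≤ dist (x i) (x m) → β * dist (x i) (x m) ≤ energy x i - energy x m)
    (hK : ∀ i, dist (x i) (x m) < 2 ^ K * ρ)
    (G : Finset (Fin N))
    (hG : ∀ i ∈ G, i ∈ (trimed x σ).computed ∧ ρ ≤ dist (x i) (x m) ∧
      ∃ k, σ.symm k < σ.symm i ∧ energy x k ≤ energy x m + β * ρ / 2) :
    (G.card : ℝ) ≤ K * (1 + 8 / β) ^ d := by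
  refine card_le_of_card_shell_le G (fun i => dist (x i) (x m)) hρ K
    (fun i hi => ⟨(hG i hi).2.1, hK i⟩) ?_
  intro w hw G' hG' hw'
  have hw0 : 0 < w := hρ.trans_le hw
  have h := card_computed_le_of_gap x σ (x m) G' (R := 2 * w)
    (s := β * w / 2) (by positivity) (by positivity) ?_
  · have e : 2 * (2 * w) / (β * w / 2) = 8 / β := by field_simp; norm_num
    rw [e] at h
    simpa using h
  intro i hi
  obtain ⟨h1, h2, k, hk, hke⟩ := hG i (hG' hi)
  refine ⟨h1, (hw' i hi).2, k, hk, hke.trans ?_⟩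
  have h4 := hgrowth i h2
  have h5 : β * w ≤ β * dist (x i) (x m) := by
    have := (hw' i hi).1
    gcongr
  have h6 : β * ρ ≤ β * w := by gcongr
  linarith

theorem sum_card_filter_forall_lt_le {N : ℕ} (X S : Finset (Fin N)) {a s : ℝ} (hs : 0 < s)
    (hX : (X.card : ℝ) ≤ a) (hS : s ≤ S.card) :
    ∑ σ : Equiv.Perm (Fin N),
      ((X.filter fun i => ∀ k ∈ S, k ≠ i → σ.symm i < σ.symm k).card : ℝ) ≤
      N.factorial * (a / s) := by
  have h1 : ∀ i, ((Finset.univ.filter fun σ : Equiv.Perm (Fin N) =>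
      ∀ k ∈ S, k ≠ i → σ.symm i < σ.symm k).card : ℝ) ≤ N.factorial / s := by
    intro i
    rw [le_div_iff₀ hs]
    have h := card_perm_forall_lt_mul_card_le i S
    calc _ ≤ ((Finset.univ.filter fun σ : Equiv.Perm (Fin N) =>
          ∀ k ∈ S, k ≠ i → σ.symm i < σ.symm k).card : ℝ) * S.card := by gcongr
      _ ≤ N.factorial := by exact_mod_cast h
  calc ∑ σ : Equiv.Perm (Fin N),
      ((X.filter fun i => ∀ k ∈ S, k ≠ i → σ.symm i < σ.symm k).card : ℝ)
      = ∑ i ∈ X, ((Finset.univ.filter fun σ : Equiv.Perm (Fin N) =>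
      ∀ k ∈ S, k ≠ i → σ.symm i < σ.symm k).card : ℝ) := by
        simp only [Finset.card_filter, Nat.cast_sum]
        exact Finset.sum_comm
    _ ≤ ∑ _i ∈ X, (N.factorial / s : ℝ) := Finset.sum_le_sum fun i _ => h1 i
    _ = X.card * (N.factorial / s) := by simp
    _ ≤ a * (N.factorial / s) := by gcongr
    _ = _ := by ring

/-- The mean number of computed elements over all orders, for a fixed set. -/
theorem sum_numComputed_le {d : ℕ} (hd : 0 < d) {N : ℕ} (x : Fin N → EuclideanSpace ℝ (Fin d))
    (m : Fin N) {α β ρ r w₁ η₀ η₁ a a₁ s₀ s₁ : ℝ} (hα : 0 < α) (hβ : 0 < β) (hρ0 : 0 < ρ)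
    (hr : 0 < r) (hw₁ : 0 < w₁) (hs₀ : 0 < s₀) (hs₁ : 0 < s₁)
    (hρ : α * ρ * d ≤ 4) (K : ℕ)
    (hgrowth : ∀ i, dist (x i) (x m) ≤ ρ → r ≤ dist (x i) (x m) →
      α * dist (x i) (x m) ^ 2 ≤ energy x i - energy x m)
    (hfar : ∀ i, ρ ≤ dist (x i) (x m) → β * dist (x i) (x m) ≤ energy x i - energy x m)
    (hK : ∀ i, dist (x i) (x m) < 2 ^ K * ρ)
    (hw₁β : α / (2 * d) * w₁ ^ 2 ≤ β * ρ / 2)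
    (hη₀ : ∀ k, dist (x k) (x m) ≤ η₀ → energy x k ≤ energy x m + α / (2 * d) * r ^ 2)
    (hη₁ : ∀ k, dist (x k) (x m) ≤ η₁ → energy x k ≤ energy x m + α / (2 * d) * w₁ ^ 2)
    (ha : ((Finset.univ.filter fun i => dist (x i) (x m) ≤ r).card : ℝ) ≤ a)
    (ha₁ : ((Finset.univ.filter fun i => dist (x i) (x m) ≤ w₁).card : ℝ) ≤ a₁)
    (hS₀ : s₀ ≤ (Finset.univ.filter fun i => dist (x i) (x m) ≤ η₀).card)
    (hS₁ : s₁ ≤ (Finset.univ.filter fun i => dist (x i) (x m) ≤ η₁).card) :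
    ∑ σ : Equiv.Perm (Fin N), (numComputed x σ : ℝ) ≤ N.factorial *
      (a + 12 * (4 / α) ^ d * r⁻¹ ^ d + K * (1 + 8 / β) ^ d + a₁ / s₀ + N / s₁) := by
  classical
  set w : Fin N → ℝ := fun i => dist (x i) (x m) with hw
  set θ : ℝ := α / (2 * d) with hθ
  have hθ0 : 0 ≤ θ := by positivity
  set S₀ := Finset.univ.filter fun i => w i ≤ η₀
  set S₁ := Finset.univ.filter fun i => w i ≤ η₁
  set A := Finset.univ.filter fun i => w i ≤ r
  set A₁ := Finset.univ.filter fun i => w i ≤ w₁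
  let Gn : Equiv.Perm (Fin N) → Finset (Fin N) := fun σ => (trimed x σ).computed.filter fun i =>
    r ≤ w i ∧ w i ≤ ρ ∧ ∃ k, σ.symm k < σ.symm i ∧ energy x k ≤ energy x m + θ * w i ^ 2
  let Gf : Equiv.Perm (Fin N) → Finset (Fin N) := fun σ => (trimed x σ).computed.filter fun i =>
    ρ ≤ w i ∧ ∃ k, σ.symm k < σ.symm i ∧ energy x k ≤ energy x m + β * ρ / 2
  -- `B₀` and `B₁` take the elements outside `A` without a suitable earlier reference. Near the
  -- medoid the demand on the reference is strict and only the small set `S₀` meets it, but there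
  -- are few such elements. Beyond `w₁` the larger set `S₁` is good enough.
  let B₀ : Equiv.Perm (Fin N) → Finset (Fin N) := fun σ =>
    A₁.filter fun i => ∀ k ∈ S₀, k ≠ i → σ.symm i < σ.symm k
  let B₁ : Equiv.Perm (Fin N) → Finset (Fin N) := fun σ =>
    Finset.univ.filter fun i => ∀ k ∈ S₁, k ≠ i → σ.symm i < σ.symm k
  have before : ∀ (σ : Equiv.Perm (Fin N)) (i : Fin N) (e : ℝ),
      (¬ ∃ k, σ.symm k < σ.symm i ∧ energy x k ≤ e) → ∀ S : Finset (Fin N),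
      (∀ k ∈ S, energy x k ≤ e) → ∀ k ∈ S, k ≠ i → σ.symm i < σ.symm k := by
    intro σ i e hn S hS k hk hki
    by_contra! h
    exact hn ⟨k, lt_of_le_of_ne h (σ.symm.injective.ne hki), hS k hk⟩
  have cover : ∀ σ, (trimed x σ).computed ⊆ A ∪ Gn σ ∪ Gf σ ∪ B₀ σ ∪ B₁ σ := by
    intro σ i hi
    by_cases h1 : w i ≤ r
    · simp [A, h1]
    push Not at h1
    rcases le_or_gt (w i) ρ with h2 | h2
    · by_cases h3 : ∃ k, σ.symm k < σ.symm i ∧ energy x k ≤ energy x m + θ * w i ^ 2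
      · have : i ∈ Gn σ := Finset.mem_filter.2 ⟨hi, h1.le, h2, h3⟩
        simp [this]
      · rcases le_or_gt (w i) w₁ with h4 | h4
        · have : i ∈ B₀ σ := by
            refine Finset.mem_filter.2 ⟨by simp [A₁, h4], before σ i _ h3 S₀ fun k hk => ?_⟩
            refine (hη₀ k (Finset.mem_filter.1 hk).2).trans ?_
            gcongr
          simp [this]
        · have : i ∈ B₁ σ := by
            refine Finset.mem_filter.2 ⟨by simp, before σ i _ h3 S₁ fun k hk => ?_⟩
            refine (hη₁ k (Finset.mem_filter.1 hk).2).trans ?_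
            gcongr
          simp [this]
    · by_cases h3 : ∃ k, σ.symm k < σ.symm i ∧ energy x k ≤ energy x m + β * ρ / 2
      · have : i ∈ Gf σ := Finset.mem_filter.2 ⟨hi, h2.le, h3⟩
        simp [this]
      · have : i ∈ B₁ σ := by
          refine Finset.mem_filter.2 ⟨by simp, before σ i _ h3 S₁ fun k hk => ?_⟩
          refine (hη₁ k (Finset.mem_filter.1 hk).2).trans ?_
          gcongr
        simp [this]
  have hcard : ∀ σ, (numComputed x σ : ℝ) ≤
      (a + 12 * (4 / α) ^ d * r⁻¹ ^ d + K * (1 + 8 / β) ^ d) + ((B₀ σ).card + (B₁ σ).card) := by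
    intro σ
    have h1 : numComputed x σ ≤ A.card + (Gn σ).card + (Gf σ).card + (B₀ σ).card + (B₁ σ).card := by
      refine (Finset.card_le_card (cover σ)).trans ?_
      refine (Finset.card_union_le _ _).trans (Nat.add_le_add_right ?_ _)
      refine (Finset.card_union_le _ _).trans (Nat.add_le_add_right ?_ _)
      refine (Finset.card_union_le _ _).trans (Nat.add_le_add_right ?_ _)
      exact Finset.card_union_le _ _
    have h2 : (numComputed x σ : ℝ) ≤
        A.card + (Gn σ).card + (Gf σ).card + (B₀ σ).card + (B₁ σ).card := by exact_mod_cast h1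
    have h3 := card_computed_near_le hd x σ m hα hr hρ hgrowth (Gn σ) fun i hi => by
      simpa only [Gn, Finset.mem_filter] using hi
    have h4 := card_computed_far_le x σ m hβ hρ0 K hfar hK (Gf σ) fun i hi => by
      simpa only [Gf, Finset.mem_filter] using hi
    linarith
  have hb₀ := sum_card_filter_forall_lt_le A₁ S₀ hs₀ ha₁ hS₀
  have hb₁ := sum_card_filter_forall_lt_le (Finset.univ : Finset (Fin N)) S₁ (a := N) hs₁
    (by simp) hS₁
  calc ∑ σ : Equiv.Perm (Fin N), (numComputed x σ : ℝ)
      ≤ ∑ σ : Equiv.Perm (Fin N), ((a + 12 * (4 / α) ^ d * r⁻¹ ^ d + K * (1 + 8 / β) ^ d) +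
          (((B₀ σ).card : ℝ) + (B₁ σ).card)) := Finset.sum_le_sum fun σ _ => hcard σ
    _ = N.factorial * (a + 12 * (4 / α) ^ d * r⁻¹ ^ d + K * (1 + 8 / β) ^ d) +
          (∑ σ, ((B₀ σ).card : ℝ) + ∑ σ, ((B₁ σ).card : ℝ)) := by
        rw [Finset.sum_add_distrib, Finset.sum_add_distrib (f := fun σ => ((B₀ σ).card : ℝ)),
          Finset.sum_const, nsmul_eq_mul, Finset.card_univ, Fintype.card_perm, Fintype.card_fin]
    _ ≤ N.factorial * (a + 12 * (4 / α) ^ d * r⁻¹ ^ d + K * (1 + 8 / β) ^ d) +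
          (N.factorial * (a₁ / s₀) + N.factorial * (N / s₁)) := by
        gcongr
    _ = _ := by ring

/-! ### Counting sample points in balls around sample points -/

theorem lintegral_pi_prod_eq_pow {E : Type*} [MeasurableSpace E] (μ : Measure E)
    [IsProbabilityMeasure μ] {h : E → ℝ≥0∞} (hh : Measurable h) (n : ℕ) :
    ∫⁻ x, ∏ i, h (x i) ∂(Measure.pi fun _ : Fin n => μ) = (∫⁻ y, h y ∂μ) ^ n := by
  induction n with
  | zero => simp
  | succ n ih =>
    have hmp := measurePreserving_piFinSuccAbove (fun _ : Fin (n + 1) => μ) 0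
    have e : ∀ x : Fin (n + 1) → E, ∏ i, h (x i) =
        (fun q : E × (Fin n → E) => h q.1 * ∏ i, h (q.2 i))
          (MeasurableEquiv.piFinSuccAbove (fun _ => E) 0 x) := by
      intro x
      rw [Fin.prod_univ_succ]
      rfl
    have hm : Measurable fun x : Fin n → E => ∏ i, h (x i) :=
      Finset.measurable_fun_prod _ fun i _ => hh.comp (measurable_pi_apply i)
    have hF : Measurable fun q : E × (Fin n → E) => h q.1 * ∏ i, h (q.2 i) :=
      (hh.comp measurable_fst).mul (hm.comp measurable_snd)
    refine (lintegral_congr e).trans ((hmp.lintegral_comp hF).trans ?_)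
    rw [lintegral_prod_mul hh.aemeasurable hm.aemeasurable, ih, pow_succ, mul_comm]

/-- Fubini with the coordinate `j` split off: given `x j`, the other `N - 1` points are still
independent, so balls centred at a sample point can be treated like fixed ones. -/
theorem lintegral_prod_compl_singleton_le {E : Type*} [MeasurableSpace E] (μ : Measure E)
    [IsProbabilityMeasure μ] {g : E → E → ℝ≥0∞} (hg : Measurable (Function.uncurry g)) {M : ℝ≥0∞}
    (hM : ∀ y, ∫⁻ z, g y z ∂μ ≤ M) {N : ℕ} (j : Fin N) :
    ∫⁻ x, ∏ k ∈ ({j} : Finset (Fin N))ᶜ, g (x j) (x k) ∂(Measure.pi fun _ : Fin N => μ) ≤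
      M ^ (N - 1) := by
  obtain ⟨n, rfl⟩ : ∃ n, N = n + 1 := ⟨N - 1, by have := j.pos; omega⟩
  have hmp := measurePreserving_piFinSuccAbove (fun _ : Fin (n + 1) => μ) j
  have e : ∀ x : Fin (n + 1) → E, ∏ k ∈ ({j} : Finset (Fin (n + 1)))ᶜ, g (x j) (x k) =
      (fun q : E × (Fin n → E) => ∏ i, g q.1 (q.2 i))
        (MeasurableEquiv.piFinSuccAbove (fun _ => E) j x) := by
    intro x
    rw [← Fin.image_succAbove_univ, Finset.prod_image (Fin.succAbove_right_injective.injOn)]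
    rfl
  have hm : Measurable fun q : E × (Fin n → E) => ∏ i, g q.1 (q.2 i) :=
    Finset.measurable_fun_prod _ fun i _ =>
      hg.comp (measurable_fst.prodMk ((measurable_pi_apply i).comp measurable_snd))
  refine ((lintegral_congr e).trans (hmp.lintegral_comp hm)).trans_le ?_
  rw [lintegral_prod _ hm.aemeasurable]
  calc _ = ∫⁻ y, (∫⁻ z, g y z ∂μ) ^ n ∂μ := by
        refine lintegral_congr fun y => ?_
        exact lintegral_pi_prod_eq_pow μ (hg.comp measurable_prodMk_left) n
    _ ≤ ∫⁻ _y, M ^ n ∂μ := lintegral_mono fun y => pow_le_pow_left₀ zero_le (hM y) n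
    _ = _ := by simp

/-- Markov's inequality for a product over the other points. -/
theorem ofReal_exp_mul_measure_le {E : Type*} [MeasurableSpace E] (μ : Measure E)
    [IsProbabilityMeasure μ] {g : E → E → ℝ≥0∞} (hg : Measurable (Function.uncurry g)) {b v : ℝ}
    (hM : ∀ y, ∫⁻ z, g y z ∂μ ≤ ENNReal.ofReal (Real.exp b)) {N : ℕ} (j : Fin N)
    (B : Set (Fin N → E))
    (hB : ∀ x ∈ B, ENNReal.ofReal (Real.exp v) ≤
      ∏ k ∈ ({j} : Finset (Fin N))ᶜ, g (x j) (x k)) :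
    Measure.pi (fun _ : Fin N => μ) B ≤ ENNReal.ofReal (Real.exp ((N - 1) * b - v)) := by
  have hm : Measurable fun x : Fin N → E => ∏ k ∈ ({j} : Finset (Fin N))ᶜ, g (x j) (x k) :=
    Finset.measurable_fun_prod _ fun i _ =>
      Measurable.comp (g := Function.uncurry g) (f := fun x : Fin N → E => (x j, x i)) hg
        ((measurable_pi_apply j).prodMk (measurable_pi_apply i))
  have h1 := mul_meas_ge_le_lintegral (μ := Measure.pi fun _ : Fin N => μ) hm
    (ENNReal.ofReal (Real.exp v))
  have h2 := h1.trans (lintegral_prod_compl_singleton_le μ hg hM j)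
  have h3 : Measure.pi (fun _ : Fin N => μ) B ≤ Measure.pi (fun _ : Fin N => μ)
      {x | ENNReal.ofReal (Real.exp v) ≤ ∏ k ∈ ({j} : Finset (Fin N))ᶜ, g (x j) (x k)} :=
    measure_mono hB
  have h4 : ENNReal.ofReal (Real.exp v) * Measure.pi (fun _ : Fin N => μ) B ≤
      ENNReal.ofReal (Real.exp v) * ENNReal.ofReal (Real.exp ((N - 1) * b - v)) := by
    refine (mul_le_mul_right h3 _).trans (h2.trans (le_of_eq ?_))
    rw [← ENNReal.ofReal_mul (Real.exp_pos _).le, ← Real.exp_add,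
      ← ENNReal.ofReal_pow (Real.exp_pos _).le, ← Real.exp_nat_mul]
    congr 2
    have : 1 ≤ N := j.pos
    push_cast [this]
    ring
  exact (ENNReal.mul_le_mul_iff_right (by simp [Real.exp_pos]) ENNReal.ofReal_ne_top).1 h4

section Chernoff

variable {E : Type*} [NormedAddCommGroup E] [MeasurableSpace E] [BorelSpace E]
  [SecondCountableTopology E] (μ : Measure E) [IsProbabilityMeasure μ]

theorem measurableSet_dist_add_le (u : E) (R : ℝ) :
    MeasurableSet {q : E × E | dist q.2 (q.1 + u) ≤ R} :=
  measurableSet_le (by fun_prop) measurable_const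

theorem measurable_measure_closedBall_add (u : E) (R : ℝ) :
    Measurable fun y => μ (Metric.closedBall (y + u) R) :=
  measurable_measure_prodMk_left (ν := μ) (measurableSet_dist_add_le u R)

/-- Chernoff bound with weight `e` per point in the ball: each factor has mean at most `1 + (e - 1)
P ≤ exp (2P)`, against `exp (3NP)` on the event. The weight is `1` where the mass exceeds `P`, which
makes the bound uniform in the centre. -/
theorem measure_exists_card_gt_le (u : E) (R : ℝ) {P : ℝ} (hP : 0 ≤ P) (N : ℕ) :
    Measure.pi (fun _ : Fin N => μ) {x | ∃ j, μ (Metric.closedBall (x j + u) R) ≤ ENNReal.ofReal P ∧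
      3 * N * P < (({j} : Finset (Fin N))ᶜ.filter fun k => dist (x k) (x j + u) ≤ R).card} ≤
    ENNReal.ofReal (N * Real.exp (-(N * P))) := by
  classical
  let g : E → E → ℝ≥0∞ := fun y z => if μ (Metric.closedBall (y + u) R) ≤ ENNReal.ofReal P ∧
    dist z (y + u) ≤ R then ENNReal.ofReal (Real.exp 1) else 1
  have hg : Measurable (Function.uncurry g) := by
    refine Measurable.ite ?_ measurable_const measurable_const
    exact (measurableSet_le ((measurable_measure_closedBall_add μ u R).comp measurable_fst)
      measurable_const).inter (measurableSet_dist_add_le u R)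
  have hM : ∀ y, ∫⁻ z, g y z ∂μ ≤ ENNReal.ofReal (Real.exp (2 * P)) := by
    intro y
    have h1P : ENNReal.ofReal 1 ≤ ENNReal.ofReal (Real.exp (2 * P)) :=
      ENNReal.ofReal_le_ofReal (Real.one_le_exp (by positivity))
    by_cases hy : μ (Metric.closedBall (y + u) R) ≤ ENNReal.ofReal P
    · have hle : ∀ z, g y z = 1 + (Metric.closedBall (y + u) R).indicator
          (fun _ => ENNReal.ofReal (Real.exp 1 - 1)) z := by
        intro z
        simp only [g, hy, true_and, Set.indicator_apply, Metric.mem_closedBall]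
        split_ifs
        · rw [← ENNReal.ofReal_one, ← ENNReal.ofReal_add zero_le_one]
          · congr 1; ring
          · linarith [Real.add_one_le_exp (1 : ℝ)]
        · simp
      simp_rw [hle]
      rw [lintegral_add_left measurable_const, lintegral_const, measure_univ, one_mul,
        lintegral_indicator_const Metric.isClosed_closedBall.measurableSet]
      calc _ ≤ 1 + ENNReal.ofReal (Real.exp 1 - 1) * ENNReal.ofReal P := by gcongr
        _ = ENNReal.ofReal (1 + (Real.exp 1 - 1) * P) := by
          have : 0 ≤ Real.exp 1 - 1 := by linarith [Real.add_one_le_exp (1 : ℝ)]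
          rw [← ENNReal.ofReal_one, ← ENNReal.ofReal_mul this,
            ← ENNReal.ofReal_add zero_le_one (by positivity)]
        _ ≤ _ := by
          refine ENNReal.ofReal_le_ofReal ?_
          have := Real.exp_one_lt_d9
          nlinarith [Real.add_one_le_exp (2 * P)]
    · have hle : ∀ z, g y z = 1 := fun z => by simp [g, hy]
      simp_rw [hle]
      simpa using h1P
  have hsub : {x : Fin N → E | ∃ j, μ (Metric.closedBall (x j + u) R) ≤ ENNReal.ofReal P ∧
      3 * N * P < (({j} : Finset (Fin N))ᶜ.filter fun k => dist (x k) (x j + u) ≤ R).card} ⊆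
      ⋃ j, {x : Fin N → E | μ (Metric.closedBall (x j + u) R) ≤ ENNReal.ofReal P ∧
      3 * N * P < (({j} : Finset (Fin N))ᶜ.filter fun k => dist (x k) (x j + u) ≤ R).card} := by
    rintro x ⟨j, hj⟩
    exact Set.mem_iUnion.2 ⟨j, hj⟩
  refine (measure_mono hsub).trans ((measure_iUnion_fintype_le _ _).trans ?_)
  calc _ ≤ ∑ _j : Fin N, ENNReal.ofReal (Real.exp (-(N * P))) := by
        refine Finset.sum_le_sum fun j _ => ?_
        refine (ofReal_exp_mul_measure_le μ hg (v := 3 * N * P) hM j _ ?_).trans ?_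
        · rintro x ⟨hx1, hx2⟩
          simp only [g, hx1, true_and]
          rw [Finset.prod_ite, Finset.prod_const, Finset.prod_const_one, mul_one,
            ← ENNReal.ofReal_pow (Real.exp_pos _).le, ← Real.exp_nat_mul, mul_one]
          exact ENNReal.ofReal_le_ofReal (Real.exp_le_exp.2 hx2.le)
        · refine ENNReal.ofReal_le_ofReal (Real.exp_le_exp.2 ?_)
          linarith
    _ = _ := by
        rw [Finset.sum_const, nsmul_eq_mul, Finset.card_univ, Fintype.card_fin,
          ENNReal.ofReal_mul (Nat.cast_nonneg N), ENNReal.ofReal_natCast]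

/-- The lower tail, with weight `1/e` per point in the ball and `0` for centres whose ball has mass
below `P`. Each factor has mean at most `exp (-P/2)`, and `N ≥ 2` gives `N - 1 ≥ N/2`. -/
theorem measure_exists_card_lt_le (u : E) (R : ℝ) {P : ℝ} (hP : 0 ≤ P) {N : ℕ} (hN : 2 ≤ N) :
    Measure.pi (fun _ : Fin N => μ) {x | ∃ j, ENNReal.ofReal P ≤ μ (Metric.closedBall (x j + u) R) ∧
      (((({j} : Finset (Fin N))ᶜ.filter fun k => dist (x k) (x j + u) ≤ R).card : ℕ) : ℝ) <
        N * P / 8} ≤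
    ENNReal.ofReal (N * Real.exp (-(N * P / 8))) := by
  classical
  let g : E → E → ℝ≥0∞ := fun y z => if ENNReal.ofReal P ≤ μ (Metric.closedBall (y + u) R) then
    (if dist z (y + u) ≤ R then ENNReal.ofReal (Real.exp (-1)) else 1) else 0
  have hg : Measurable (Function.uncurry g) := by
    refine Measurable.ite ?_ (Measurable.ite ?_ measurable_const measurable_const) measurable_const
    · exact measurableSet_le measurable_const
        ((measurable_measure_closedBall_add μ u R).comp measurable_fst)
    · exact measurableSet_dist_add_le u R
  have he : Real.exp (-1) ≤ 1 / 2 := by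
    rw [Real.exp_neg, inv_eq_one_div]
    exact one_div_le_one_div_of_le (by norm_num) (by linarith [Real.add_one_le_exp (1 : ℝ)])
  have hM : ∀ y, ∫⁻ z, g y z ∂μ ≤ ENNReal.ofReal (Real.exp (-(P / 2))) := by
    intro y
    by_cases hy : ENNReal.ofReal P ≤ μ (Metric.closedBall (y + u) R)
    · set S := Metric.closedBall (y + u) R with hS
      have hSm : MeasurableSet S := Metric.isClosed_closedBall.measurableSet
      have hle : ∀ z, g y z = S.indicator (fun _ => ENNReal.ofReal (Real.exp (-1))) z +
          Sᶜ.indicator (fun _ => 1) z := by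
        intro z
        have hz : z ∈ S ↔ dist z (y + u) ≤ R := Metric.mem_closedBall
        by_cases h : dist z (y + u) ≤ R
        · simp [g, ← hS, hy, h, hz]
        · simp [g, ← hS, hy, h, hz]
      simp_rw [hle]
      rw [lintegral_add_left (measurable_const.indicator hSm), lintegral_indicator_const hSm,
        lintegral_indicator_const hSm.compl, one_mul, ← ofReal_measureReal (s := S),
        ← ofReal_measureReal (s := Sᶜ), probReal_compl_eq_one_sub hSm,
        ← ENNReal.ofReal_mul (Real.exp_pos _).le]
      have hq1 : μ.real S ≤ 1 := measureReal_le_one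
      have hq0 : P ≤ μ.real S := (ENNReal.ofReal_le_iff_le_toReal (measure_ne_top _ _)).1 hy
      rw [← ENNReal.ofReal_add (by positivity) (by linarith)]
      refine ENNReal.ofReal_le_ofReal ?_
      nlinarith [Real.add_one_le_exp (-(P / 2))]
    · have hle : ∀ z, g y z = 0 := fun z => by simp [g, hy]
      simp_rw [hle]
      simp
  have hsub : {x : Fin N → E | ∃ j, ENNReal.ofReal P ≤ μ (Metric.closedBall (x j + u) R) ∧
      (((({j} : Finset (Fin N))ᶜ.filter fun k => dist (x k) (x j + u) ≤ R).card : ℕ) : ℝ) <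
        N * P / 8} ⊆
      ⋃ j, {x : Fin N → E | ENNReal.ofReal P ≤ μ (Metric.closedBall (x j + u) R) ∧
      (((({j} : Finset (Fin N))ᶜ.filter fun k => dist (x k) (x j + u) ≤ R).card : ℕ) : ℝ) <
        N * P / 8} := by
    rintro x ⟨j, hj⟩
    exact Set.mem_iUnion.2 ⟨j, hj⟩
  refine (measure_mono hsub).trans ((measure_iUnion_fintype_le _ _).trans ?_)
  calc _ ≤ ∑ _j : Fin N, ENNReal.ofReal (Real.exp (-(N * P / 8))) := by
        refine Finset.sum_le_sum fun j _ => ?_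
        refine (ofReal_exp_mul_measure_le μ hg (v := -(N * P / 8)) hM j _ ?_).trans ?_
        · rintro x ⟨hx1, hx2⟩
          simp only [g, hx1, if_true]
          rw [Finset.prod_ite, Finset.prod_const, Finset.prod_const_one, mul_one,
            ← ENNReal.ofReal_pow (Real.exp_pos _).le, ← Real.exp_nat_mul]
          refine ENNReal.ofReal_le_ofReal (Real.exp_le_exp.2 ?_)
          linarith
        · refine ENNReal.ofReal_le_ofReal (Real.exp_le_exp.2 ?_)
          have : (2 : ℝ) ≤ N := by exact_mod_cast hN
          nlinarith
    _ = _ := by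
        rw [Finset.sum_const, nsmul_eq_mul, Finset.card_univ, Fintype.card_fin,
          ENNReal.ofReal_mul (Nat.cast_nonneg N), ENNReal.ofReal_natCast]

end Chernoff

theorem measure_exists_norm_ge_le {E : Type*} [NormedAddCommGroup E] [MeasurableSpace E]
    [OpensMeasurableSpace E] (μ : Measure E) [IsProbabilityMeasure μ] {a : ℝ} (ha : 0 < a) (N : ℕ) :
    Measure.pi (fun _ : Fin N => μ) {x | ∃ j, a ≤ ‖x j‖} ≤
      N * ((∫⁻ y, ENNReal.ofReal ‖y‖ ∂μ) / ENNReal.ofReal a) := by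
  have hsub : {x : Fin N → E | ∃ j, a ≤ ‖x j‖} ⊆
      ⋃ j, (fun x : Fin N → E => x j) ⁻¹' {y | a ≤ ‖y‖} := by
    rintro x ⟨j, hj⟩
    exact Set.mem_iUnion.2 ⟨j, hj⟩
  refine (measure_mono hsub).trans ((measure_iUnion_fintype_le _ _).trans ?_)
  calc _ ≤ ∑ _j : Fin N, (∫⁻ y, ENNReal.ofReal ‖y‖ ∂μ) / ENNReal.ofReal a := by
        refine Finset.sum_le_sum fun j _ => ?_
        rw [(measurePreserving_eval (fun _ : Fin N => μ) j).measure_preimage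
          (measurableSet_le measurable_const (by fun_prop)).nullMeasurableSet]
        have h := meas_ge_le_lintegral_div (μ := μ) (f := fun y : E => ENNReal.ofReal ‖y‖)
          (by fun_prop) (ε := ENNReal.ofReal a) (by simpa using ha) ENNReal.ofReal_ne_top
        refine (measure_mono ?_).trans h
        intro y hy
        exact ENNReal.ofReal_le_ofReal hy
    _ = _ := by simp

/-! ### The length scale

All radii below are multiples of powers of `z = N ^ (-1 / (40 d))`, so that `N * z ^ (40 d) = 1`. -/

/-- Flatness of the mean distance near the medoid, at the scale `z ^ 16`. -/
theorem meanDist_le_of_dense_axes {d : ℕ} (hd : 0 < d) {N : ℕ}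
    (x : Fin N → EuclideanSpace ℝ (Fin d)) (m : Fin N) (hm : IsMedoid x m) {z A : ℝ} (hz : 0 < z)
    (hz1 : z ≤ 1) (hA : 0 ≤ A) (hNz : (N : ℝ) * z ^ (40 * d) = 1)
    (haxes : ∀ k, ∀ b : ℝ, |b| = z ^ 16 →
      ∃ i, dist (x i) (x m + EuclideanSpace.single k b) ≤ z ^ 24)
    (hcard : ((Finset.univ.filter fun i => dist (x i) (x m) ≤ z ^ 8).card : ℝ) ≤
      3 * N * (A * (z ^ 8) ^ d) + 1) (v : EuclideanSpace ℝ (Fin d)) (hv : ‖v‖ ≤ z ^ 16 / d) :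
    meanDist x (x m + v) ≤ meanDist x (x m) + d * ((6 * A + 4) * z ^ 8) * ‖v‖ := by
  have hN : (0 : ℝ) < N := by exact_mod_cast m.pos
  refine (convexOn_meanDist x).le_add_norm_of_axes (x m) (by positivity) (by positivity) hd ?_ v hv
  intro k b hb
  have hnorm : ‖(EuclideanSpace.single k b : EuclideanSpace ℝ (Fin d))‖ = z ^ 16 := by simpa using hb
  have h := meanDist_add_le_of_isLeast x (x m) (EuclideanSpace.single k b) (t := z ^ 8)
    (κ := z ^ 24) (by positivity) hm (by
      have e : x m - EuclideanSpace.single k b = x m + EuclideanSpace.single k (-b) := by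
        rw [sub_eq_add_neg]; congr 1; ext j; simp; split_ifs <;> simp
      rw [e]
      exact haxes k (-b) (by rwa [abs_neg]))
  rw [hnorm] at h
  have h1 : (z ^ 8) ^ d ≤ z ^ 8 := pow_le_of_le_one (by positivity) (pow_le_one₀ hz.le hz1) hd.ne'
  -- Used to absorb the `1` in `hcard`, written as `N * z ^ (40 * d)`. The slope `6 A + 4` is then
  -- `2 (3 A + 1)` from the close points, `1` from the quadratic term and `1` from `κ = z ^ 24`.
  have h2 : z ^ (40 * d) ≤ z ^ 8 := pow_le_pow_of_le_one hz.le hz1 (by omega)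
  have h3 : ((Finset.univ.filter fun i => dist (x i) (x m) ≤ z ^ 8).card : ℝ) / N ≤
      (3 * A + 1) * z ^ 8 := by
    rw [div_le_iff₀ hN]
    calc _ ≤ 3 * N * (A * (z ^ 8) ^ d) + N * z ^ (40 * d) := by rw [hNz]; exact hcard
      _ ≤ 3 * N * (A * z ^ 8) + N * z ^ 8 := by gcongr
      _ = _ := by ring
  have h4 : (z ^ 16) ^ 2 / z ^ 8 = z ^ 24 := by field_simp
  rw [h4] at h
  refine h.trans ?_
  have h5 : 2 * z ^ 16 * (((Finset.univ.filter fun i => dist (x i) (x m) ≤ z ^ 8).card : ℝ) / N) ≤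
      2 * z ^ 16 * ((3 * A + 1) * z ^ 8) := by gcongr
  nlinarith

/-- The mean number of computed elements for a set that is in good position relative to its
medoid. -/
theorem sum_numComputed_le_of_good {d : ℕ} (hd : 0 < d) {N : ℕ}
    (x : Fin N → EuclideanSpace ℝ (Fin d)) (m : Fin N) (hm : IsMedoid x m)
    {z y A α ρ κ b c : ℝ} (hz : 0 < z) (hz1 : z ≤ 1) (hA : 0 ≤ A) (hα : 0 < α) (hρ0 : 0 < ρ)
    (hc : 0 < c) (hN : (N : ℝ) = y ^ 40) (hy : y * z ^ d = 1)
    (hρ : α * ρ * d ≤ 4) (hκ : κ ≤ ρ / 4) (hκ' : κ ≤ α * ρ ^ 2 / 32)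
    (hb : b * (d * (6 * A + 4)) = α / (2 * d))
    (hzr : z ≤ ρ / 4) (hzb : z * (b * d) ≤ 1)
    (hzw : α / (2 * d) * z ≤ α * ρ / 16 * ρ / 2) (K : ℕ)
    (hK : ∀ i, dist (x i) (x m) < 2 ^ K * ρ)
    (hgrowth : ∀ i, dist (x i) (x m) ≤ ρ → z ^ 20 ≤ dist (x i) (x m) →
      α * dist (x i) (x m) ^ 2 ≤ energy x i - energy x m)
    (hupper : ∀ q ∈ ({20, 13, 8} : Finset ℕ),
      ((Finset.univ.filter fun i => dist (x i) (x m) ≤ z ^ q).card : ℝ) ≤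
        3 * N * (A * (z ^ q) ^ d) + 1)
    (hlower : ∀ q ∈ ({32, 18} : Finset ℕ), c * (N * (z ^ q) ^ d) ≤
      ((Finset.univ.filter fun i => dist (x i) (x m) ≤ b * z ^ q).card : ℝ))
    (haxes : ∀ k, ∀ b : ℝ, |b| = z ^ 16 →
      ∃ i, dist (x i) (x m + EuclideanSpace.single k b) ≤ z ^ 24)
    (hdense : ∀ u : EuclideanSpace ℝ (Fin d), ‖u‖ = ρ / 2 → ∃ k, dist (x k) (x m + u) ≤ κ) :
    ∑ σ : Equiv.Perm (Fin N), (numComputed x σ : ℝ) ≤ N.factorial *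
      ((3 * A * y ^ 20 + 1) + 12 * (4 / α) ^ d * y ^ 20 + K * (1 + 8 / (α * ρ / 16)) ^ d +
        (3 * A * y ^ 27 + 1) / (c * y ^ 8) + y ^ 40 / (c * y ^ 22)) := by
  have hd' : (0 : ℝ) < d := by exact_mod_cast hd
  have hzd : 0 < z ^ d := by positivity
  have hy0 : 0 < y := by
    by_contra! h
    nlinarith
  have hyz : ∀ n k : ℕ, y ^ (n + k) * (z ^ k) ^ d = y ^ n := by
    intro n k
    rw [← pow_mul, mul_comm k d, pow_mul, pow_add, mul_assoc, ← mul_pow, hy, one_pow, mul_one]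
  have hNz : (N : ℝ) * z ^ (40 * d) = 1 := by
    have := hyz 0 40
    rwa [← pow_mul, zero_add, pow_zero, ← hN] at this
  have hflat := meanDist_le_of_dense_axes hd x m hm hz hz1 hA hNz haxes
    (hupper 8 (by simp))
  have hfar : ∀ i, ρ ≤ dist (x i) (x m) →
      α * ρ / 16 * dist (x i) (x m) ≤ energy x i - energy x m := fun i hi =>
    linear_growth_of_quadratic_growth x (x m) hρ0 hα
      (r := z ^ 20) ((pow_le_of_le_one hz.le hz1 (by norm_num)).trans hzr) hκ hκ'
      hgrowth hdense (x i) hi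
  -- The slope of order `z ^ 8` at the medoid makes the excess energy within `b * z ^ q` of order `z
  -- ^ (q + 8)`, much less than the distance itself. The condition `17 ≤ q` keeps the point in the
  -- range `z ^ 16 / d` where flatness is known.
  have hnear : ∀ q p : ℕ, 17 ≤ q → q + 8 = 2 * p → ∀ k, dist (x k) (x m) ≤ b * z ^ q →
      energy x k ≤ energy x m + α / (2 * d) * (z ^ p) ^ 2 := by
    intro q p hq hqp k hk
    have hv : ‖x k - x m‖ ≤ z ^ 16 / d := by
      rw [← dist_eq_norm]
      refine hk.trans ?_
      rw [le_div_iff₀ hd']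
      have hb0 : 0 ≤ b := by
        by_contra! h
        have : 0 < α / (2 * d) := by positivity
        have : 0 < d * (6 * A + 4) := by positivity
        nlinarith
      calc b * z ^ q * d ≤ b * z ^ 17 * d := by
            have := pow_le_pow_of_le_one hz.le hz1 hq
            gcongr
        _ = z ^ 16 * (z * (b * d)) := by ring
        _ ≤ z ^ 16 * 1 := by gcongr
        _ = z ^ 16 := mul_one _
    have h := hflat (x k - x m) hv
    rw [add_sub_cancel, ← dist_eq_norm] at h
    refine h.trans ?_
    change energy x m + _ ≤ _
    have h2 : d * ((6 * A + 4) * z ^ 8) * dist (x k) (x m) ≤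
        d * ((6 * A + 4) * z ^ 8) * (b * z ^ q) := by gcongr
    have h3 : d * ((6 * A + 4) * z ^ 8) * (b * z ^ q) = α / (2 * d) * (z ^ p) ^ 2 := by
      rw [← hb, ← pow_mul, mul_comm p 2, ← hqp, pow_add]; ring
    linarith
  have hr : ((z ^ 20)⁻¹) ^ d = y ^ 20 := by
    have := hyz 0 20
    rw [inv_pow, inv_eq_iff_eq_inv, ← mul_eq_one_iff_eq_inv₀ (by positivity), mul_comm]
    simpa using this
  have hup : ∀ q n : ℕ, n + q = 40 → 3 * (N : ℝ) * (A * (z ^ q) ^ d) + 1 = 3 * A * y ^ n + 1 := by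
    intro q n hq
    rw [hN, ← hyz n q, hq]; ring
  have hlow : ∀ q n : ℕ, n + q = 40 → c * ((N : ℝ) * (z ^ q) ^ d) = c * y ^ n := by
    intro q n hq
    rw [hN, ← hyz n q, hq]
  -- The exponents satisfy `32 + 8 = 2 * 20` and `18 + 8 = 2 * 13`, as `hnear` requires. A ball of
  -- radius `z ^ q` holds about `y ^ (40 - q)` points, so the two error terms are of order `y ^ 27 /
  -- y ^ 8 = y ^ 19` and `y ^ 40 / y ^ 22 = y ^ 18`, below the main order `y ^ 20`.
  have hmain := sum_numComputed_le hd x m (β := α * ρ / 16) (r := z ^ 20) (w₁ := z ^ 13)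
    (η₀ := b * z ^ 32) (η₁ := b * z ^ 18) (a := 3 * A * y ^ 20 + 1) (a₁ := 3 * A * y ^ 27 + 1)
    (s₀ := c * y ^ 8) (s₁ := c * y ^ 22) hα (by positivity) hρ0 (by positivity) (by positivity)
    (by positivity) (by positivity) hρ K hgrowth hfar hK
    (by
      refine le_trans ?_ hzw
      gcongr
      rw [← pow_mul]
      exact pow_le_of_le_one hz.le hz1 (by norm_num))
    (hnear 32 20 (by norm_num) (by norm_num)) (hnear 18 13 (by norm_num) (by norm_num))
    (by rw [← hup 20 20 (by norm_num)]; exact hupper 20 (by simp))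
    (by rw [← hup 13 27 (by norm_num)]; exact hupper 13 (by simp))
    (by rw [← hlow 32 8 (by norm_num)]; exact hlower 32 (by simp))
    (by rw [← hlow 18 22 (by norm_num)]; exact hlower 18 (by simp))
  rw [hr, hN] at hmain
  exact hmain

/-! ### Negligible events -/

/-- The events `B N` on samples of size `N` have probability `O(1/N)`. -/
def Negligible {d : ℕ} (f : EuclideanSpace ℝ (Fin d) → ℝ)
    (B : (N : ℕ) → Set (Fin N → EuclideanSpace ℝ (Fin d))) : Prop :=
  ∃ K : ℝ, ∀ᶠ N : ℕ in Filter.atTop, sampleLaw f N (B N) ≤ ENNReal.ofReal (K / N)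

namespace Negligible

variable {d : ℕ} {f : EuclideanSpace ℝ (Fin d) → ℝ}
  {B B' : (N : ℕ) → Set (Fin N → EuclideanSpace ℝ (Fin d))}

theorem union (h : Negligible f B) (h' : Negligible f B') :
    Negligible f fun N => B N ∪ B' N := by
  obtain ⟨K, hK⟩ := h
  obtain ⟨K', hK'⟩ := h'
  refine ⟨max K 0 + max K' 0, ?_⟩
  filter_upwards [hK, hK'] with N h1 h2
  refine (measure_union_le _ _).trans ?_
  rw [add_div, ENNReal.ofReal_add (by positivity) (by positivity)]
  refine add_le_add (h1.trans ?_) (h2.trans ?_) <;>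
  · refine ENNReal.ofReal_le_ofReal ?_
    gcongr
    exact le_max_left _ _

theorem empty : Negligible f fun _ => ∅ := ⟨0, by simp⟩

theorem biUnion {ι : Type*} (T : Finset ι)
    {B : ι → (N : ℕ) → Set (Fin N → EuclideanSpace ℝ (Fin d))}
    (h : ∀ t ∈ T, Negligible f (B t)) : Negligible f fun N => ⋃ t ∈ T, B t N := by
  classical
  induction T using Finset.induction_on with
  | empty => simpa using empty
  | insert a T ha ih =>
    simp only [Finset.set_biUnion_insert]
    exact (h a (Finset.mem_insert_self _ _)).union
      (ih fun t ht => h t (Finset.mem_insert_of_mem ht))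

end Negligible

theorem unitBallVolume_pos (d : ℕ) : 0 < unitBallVolume d := by
  unfold unitBallVolume
  have := Real.Gamma_pos_of_pos (s := (d : ℝ) / 2 + 1) (by positivity)
  have := Real.pi_pos
  positivity

theorem volume_closedBall_eq_unitBallVolume {d : ℕ} (hd : 0 < d) (c : EuclideanSpace ℝ (Fin d))
    {R : ℝ} (hR : 0 ≤ R) :
    volume (Metric.closedBall c R) = ENNReal.ofReal (unitBallVolume d * R ^ d) := by
  have : Nonempty (Fin d) := ⟨⟨0, hd⟩⟩
  rw [EuclideanSpace.volume_closedBall, Fintype.card_fin, ← ENNReal.ofReal_pow hR,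
    ← ENNReal.ofReal_mul (by positivity), mul_comm]
  unfold unitBallVolume
  congr 3
  rw [Real.sqrt_eq_rpow, ← Real.rpow_natCast, ← Real.rpow_mul Real.pi_pos.le]
  congr 1
  ring

theorem withDensity_closedBall_le {d : ℕ} (hd : 0 < d) {f : EuclideanSpace ℝ (Fin d) → ℝ}
    {c : EuclideanSpace ℝ (Fin d)} {δ R : ℝ} (hδ : 0 ≤ δ)
    (hR : 0 ≤ R) (h : ∀ y ∈ Metric.closedBall c R, f y ≤ δ) :
    (volume.withDensity fun y => ENNReal.ofReal (f y)) (Metric.closedBall c R) ≤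
      ENNReal.ofReal (δ * (unitBallVolume d * R ^ d)) := by
  have hm : MeasurableSet (Metric.closedBall c R) := Metric.isClosed_closedBall.measurableSet
  rw [withDensity_apply _ hm, ENNReal.ofReal_mul hδ,
    ← volume_closedBall_eq_unitBallVolume hd c hR, ← setLIntegral_const]
  exact setLIntegral_mono measurable_const fun y hy => ENNReal.ofReal_le_ofReal (h y hy)

theorem le_withDensity_closedBall {d : ℕ} (hd : 0 < d) {f : EuclideanSpace ℝ (Fin d) → ℝ}
    (hf : Measurable f) {c : EuclideanSpace ℝ (Fin d)} {δ R : ℝ} (hδ : 0 ≤ δ)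
    (hR : 0 ≤ R) (h : ∀ y ∈ Metric.closedBall c R, δ ≤ f y) :
    ENNReal.ofReal (δ * (unitBallVolume d * R ^ d)) ≤
      (volume.withDensity fun y => ENNReal.ofReal (f y)) (Metric.closedBall c R) := by
  have hm : MeasurableSet (Metric.closedBall c R) := Metric.isClosed_closedBall.measurableSet
  rw [withDensity_apply _ hm, ENNReal.ofReal_mul hδ,
    ← volume_closedBall_eq_unitBallVolume hd c hR, ← setLIntegral_const]
  exact setLIntegral_mono hf.ennreal_ofReal fun y hy => ENNReal.ofReal_le_ofReal (h y hy)

/-! ### The sequence of scales -/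

/-- The length `N ^ (-1 / (40 d))`. -/
noncomputable def lengthScale (d N : ℕ) : ℝ := (N : ℝ) ^ (-(1 / (40 * (d : ℝ))))

/-- The number `N ^ (1 / 40)`. -/
noncomputable def countScale (N : ℕ) : ℝ := (N : ℝ) ^ (1 / 40 : ℝ)

theorem lengthScale_pos (d : ℕ) {N : ℕ} (hN : 0 < N) : 0 < lengthScale d N :=
  Real.rpow_pos_of_pos (by exact_mod_cast hN) _

theorem lengthScale_le_one (d : ℕ) {N : ℕ} (hN : 0 < N) : lengthScale d N ≤ 1 :=
  Real.rpow_le_one_of_one_le_of_nonpos (by exact_mod_cast hN)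
    (by simp only [Left.neg_nonpos_iff]; positivity)

theorem tendsto_lengthScale {d : ℕ} (hd : 0 < d) :
    Filter.Tendsto (lengthScale d) Filter.atTop (nhds 0) :=
  (tendsto_rpow_neg_atTop (by positivity)).comp tendsto_natCast_atTop_atTop

theorem tendsto_countScale : Filter.Tendsto countScale Filter.atTop Filter.atTop :=
  (tendsto_rpow_atTop (by norm_num)).comp tendsto_natCast_atTop_atTop

theorem countScale_pow (N n : ℕ) : countScale N ^ n = (N : ℝ) ^ (n / 40 : ℝ) := by
  unfold countScale
  rw [← Real.rpow_natCast, ← Real.rpow_mul (Nat.cast_nonneg N)]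
  congr 1
  ring

theorem natCast_eq_countScale_pow (N : ℕ) : (N : ℝ) = countScale N ^ 40 := by
  rw [countScale_pow]; norm_num

theorem countScale_pos {N : ℕ} (hN : 0 < N) : 0 < countScale N :=
  Real.rpow_pos_of_pos (by exact_mod_cast hN) _

theorem one_le_countScale {N : ℕ} (hN : 0 < N) : 1 ≤ countScale N :=
  Real.one_le_rpow (by exact_mod_cast hN) (by norm_num)

theorem countScale_mul_lengthScale_pow {d : ℕ} (hd : 0 < d) {N : ℕ} (hN : 0 < N) :
    countScale N * lengthScale d N ^ d = 1 := by
  have hd' : (d : ℝ) ≠ 0 := by positivity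
  unfold countScale lengthScale
  rw [← Real.rpow_natCast, ← Real.rpow_mul (Nat.cast_nonneg N),
    ← Real.rpow_add (by exact_mod_cast hN)]
  have : (1 / 40 : ℝ) + -(1 / (40 * (d : ℝ))) * d = 0 := by field_simp; norm_num
  rw [this, Real.rpow_zero]

theorem lengthScale_pow_twenty {d : ℕ} (hd : 0 < d) (N : ℕ) :
    lengthScale d N ^ 20 = (N : ℝ) ^ (-(1 / (2 * (d : ℝ)))) := by
  have hd' : (d : ℝ) ≠ 0 := by positivity
  unfold lengthScale
  rw [← Real.rpow_natCast, ← Real.rpow_mul (Nat.cast_nonneg N)]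
  congr 1
  push_cast
  field_simp
  norm_num

/-- Up to the exponent `32` a ball is still expected to hold a number of points of order at least
`N^(1/5)`, which makes the Chernoff errors superpolynomially small. -/
theorem countScale_pow_le_mul_lengthScale {d : ℕ} (hd : 0 < d) {N : ℕ} (hN : 0 < N) {b : ℝ}
    (hb : 0 ≤ b) {q : ℕ} (hq : q ≤ 32) :
    b ^ d * countScale N ^ 8 ≤ N * (b * lengthScale d N ^ q) ^ d := by
  have hy := countScale_pos hN
  have hz := lengthScale_pos d hN
  have h1 : countScale N ^ 8 = N * (lengthScale d N ^ 32) ^ d := by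
    rw [natCast_eq_countScale_pow N, ← pow_mul, mul_comm 32 d, pow_mul,
      show 40 = 8 + 32 from rfl, pow_add, mul_assoc, ← mul_pow,
      countScale_mul_lengthScale_pow hd hN, one_pow, mul_one]
  rw [h1, mul_pow, mul_left_comm]
  have := pow_le_pow_of_le_one hz.le (lengthScale_le_one d hN) hq
  gcongr

theorem eventually_mul_exp_le {c : ℝ} (hc : 0 < c) :
    ∀ᶠ N : ℕ in Filter.atTop, (N : ℝ) * Real.exp (-(c * countScale N ^ 8)) ≤ 1 / N := by
  have h1 : Filter.Tendsto (fun N => c * countScale N ^ 8) Filter.atTop Filter.atTop :=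
    ((Filter.tendsto_pow_atTop (by norm_num)).comp tendsto_countScale).const_mul_atTop hc
  -- The tenth power of `c * countScale N ^ 8` is `c ^ 10 * N ^ 2`: one factor `N` comes from the
  -- union bound, the other gives the `1 / N`.
  have h2 := ((Real.tendsto_pow_mul_exp_neg_atTop_nhds_zero 10).comp h1).eventually
    (eventually_le_nhds (show (0 : ℝ) < c ^ 10 by positivity))
  filter_upwards [h2, Filter.eventually_gt_atTop 0] with N hN hN0
  have hN' : (0 : ℝ) < N := by exact_mod_cast hN0
  simp only [Function.comp] at hN
  have e : (c * countScale N ^ 8) ^ 10 = c ^ 10 * ((N : ℝ) * N) := by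
    rw [natCast_eq_countScale_pow N]; ring
  rw [e, mul_assoc] at hN
  have h3 : (N : ℝ) * N * Real.exp (-(c * countScale N ^ 8)) ≤ 1 := by
    by_contra! h
    nlinarith [show (0 : ℝ) < c ^ 10 by positivity]
  rw [le_div_iff₀ hN']
  linarith

/-! ### The sample near its points -/

theorem negligible_card_gt {d : ℕ} (hd : 0 < d) {f : EuclideanSpace ℝ (Fin d) → ℝ}
    [IsProbabilityMeasure (volume.withDensity fun y => ENNReal.ofReal (f y))] {δ ρ : ℝ}
    (hδ : 0 < δ) (hρ : 0 < ρ) {q : ℕ} (hq0 : q ≠ 0) (hq : q ≤ 32) :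
    Negligible f fun N => {x | ∃ j, (∀ y ∈ Metric.closedBall (x j) ρ, f y ≤ δ) ∧
      3 * N * (unitBallVolume d * δ * (lengthScale d N ^ q) ^ d) + 1 <
        ((Finset.univ.filter fun k => dist (x k) (x j) ≤ lengthScale d N ^ q).card : ℝ)} := by
  have hV := unitBallVolume_pos d
  refine ⟨1, ?_⟩
  have hρz := (tendsto_lengthScale hd).eventually (eventually_le_nhds hρ)
  filter_upwards [eventually_mul_exp_le (c := δ * unitBallVolume d) (by positivity), hρz,
    Filter.eventually_gt_atTop 0] with N hN hNρ hN0
  have hz := lengthScale_pos d hN0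
  have hzq : lengthScale d N ^ q ≤ ρ :=
    (pow_le_of_le_one hz.le (lengthScale_le_one d hN0) hq0).trans hNρ
  refine le_trans (le_trans (measure_mono ?_) (measure_exists_card_gt_le
    (volume.withDensity fun y => ENNReal.ofReal (f y)) 0 (lengthScale d N ^ q)
    (P := δ * (unitBallVolume d * (lengthScale d N ^ q) ^ d)) (by positivity) N)) ?_
  · rintro x ⟨j, hj1, hj2⟩
    refine ⟨j, ?_, ?_⟩
    · rw [add_zero]
      exact withDensity_closedBall_le hd hδ.le (by positivity) fun y hy =>
        hj1 y (Metric.closedBall_subset_closedBall hzq hy)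
    · simp only [add_zero]
      -- The centre lies in its own ball but is not one of the independent points, hence the `+ 1`.
      have h1 : (Finset.univ.filter fun k => dist (x k) (x j) ≤ lengthScale d N ^ q).card ≤
          (({j} : Finset (Fin N))ᶜ.filter fun k => dist (x k) (x j) ≤ lengthScale d N ^ q).card
            + 1 := by
        rw [← Finset.card_singleton j]
        refine (Finset.card_le_card ?_).trans (Finset.card_union_le _ _)
        intro k hk
        by_cases hkj : k = j
        · simp [hkj]
        · simpa [hkj] using hk
      have h2 : ((Finset.univ.filter fun k => dist (x k) (x j) ≤ lengthScale d N ^ q).card : ℝ) ≤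
          (({j} : Finset (Fin N))ᶜ.filter fun k => dist (x k) (x j) ≤ lengthScale d N ^ q).card
            + 1 := by exact_mod_cast h1
      linarith
  · refine ENNReal.ofReal_le_ofReal (le_trans ?_ hN)
    have h := countScale_pow_le_mul_lengthScale hd hN0 zero_le_one hq
    rw [one_pow, one_mul, one_mul] at h
    refine mul_le_mul_of_nonneg_left (Real.exp_le_exp.2 (neg_le_neg ?_)) (Nat.cast_nonneg N)
    calc δ * unitBallVolume d * countScale N ^ 8
        ≤ δ * unitBallVolume d * (N * (lengthScale d N ^ q) ^ d) := by gcongr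
      _ = _ := by ring

theorem negligible_card_lt {d : ℕ} (hd : 0 < d) {f : EuclideanSpace ℝ (Fin d) → ℝ}
    (hf : Measurable f) [IsProbabilityMeasure (volume.withDensity fun y => ENNReal.ofReal (f y))]
    {δ ρ b : ℝ} (hδ : 0 < δ) (hb : 0 < b) {q : ℕ} (hq : q ≤ 32)
    (u : ℕ → EuclideanSpace ℝ (Fin d))
    (hu : ∀ᶠ N : ℕ in Filter.atTop, ‖u N‖ + b * lengthScale d N ^ q ≤ ρ) :
    Negligible f fun N => {x | ∃ j, (∀ y ∈ Metric.closedBall (x j) ρ, δ ≤ f y) ∧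
      ((Finset.univ.filter fun k => dist (x k) (x j + u N) ≤ b * lengthScale d N ^ q).card : ℝ) <
        δ * unitBallVolume d * b ^ d / 8 * (N * (lengthScale d N ^ q) ^ d)} := by
  have hV := unitBallVolume_pos d
  refine ⟨1, ?_⟩
  filter_upwards [eventually_mul_exp_le (c := δ * unitBallVolume d * b ^ d / 8) (by positivity), hu,
    Filter.eventually_ge_atTop 2] with N hN hNu hN2
  have hN0 : 0 < N := by omega
  have hz := lengthScale_pos d hN0
  have hP : N * (δ * (unitBallVolume d * (b * lengthScale d N ^ q) ^ d)) / 8 =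
      δ * unitBallVolume d * b ^ d / 8 * (N * (lengthScale d N ^ q) ^ d) := by
    rw [mul_pow]; ring
  refine le_trans (le_trans (measure_mono ?_) (measure_exists_card_lt_le
    (volume.withDensity fun y => ENNReal.ofReal (f y)) (u N) (b * lengthScale d N ^ q)
    (P := δ * (unitBallVolume d * (b * lengthScale d N ^ q) ^ d)) (by positivity) hN2)) ?_
  · rintro x ⟨j, hj1, hj2⟩
    refine ⟨j, ?_, ?_⟩
    · refine le_withDensity_closedBall hd hf hδ.le (by positivity) fun y hy =>
        hj1 y (Metric.closedBall_subset_closedBall' ?_ hy)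
      rw [dist_self_add_left]
      linarith
    · rw [hP]
      refine lt_of_le_of_lt ?_ hj2
      exact_mod_cast Finset.card_le_card (Finset.filter_subset_filter _ (Finset.subset_univ _))
  · refine ENNReal.ofReal_le_ofReal (le_trans ?_ hN)
    have h := countScale_pow_le_mul_lengthScale hd hN0 hb.le hq
    refine mul_le_mul_of_nonneg_left (Real.exp_le_exp.2 (neg_le_neg ?_)) (Nat.cast_nonneg N)
    calc δ * unitBallVolume d * b ^ d / 8 * countScale N ^ 8
        = δ * unitBallVolume d / 8 * (b ^ d * countScale N ^ 8) := by ring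
      _ ≤ δ * unitBallVolume d / 8 * (N * (b * lengthScale d N ^ q) ^ d) := by gcongr
      _ = _ := by ring

/-- Markov's inequality and a union bound. It limits the number of shells around the medoid. -/
theorem negligible_norm_ge {d : ℕ} {f : EuclideanSpace ℝ (Fin d) → ℝ} (hf : Measurable f)
    (hint : Integrable fun y => ‖y‖ * f y)
    [IsProbabilityMeasure (volume.withDensity fun y => ENNReal.ofReal (f y))] :
    Negligible f fun N => {x | ∃ j, (N : ℝ) ^ 3 ≤ ‖x j‖} := by
  have hfin : ∫⁻ y, ENNReal.ofReal ‖y‖ ∂(volume.withDensity fun y => ENNReal.ofReal (f y)) ≠ ⊤ := by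
    rw [lintegral_withDensity_eq_lintegral_mul _ hf.ennreal_ofReal (by fun_prop)]
    have h := hint.lintegral_lt_top
    refine (lt_of_le_of_lt (le_of_eq ?_) h).ne
    refine lintegral_congr fun y => ?_
    rw [Pi.mul_apply, mul_comm, ENNReal.ofReal_mul (norm_nonneg y)]
  refine ⟨(∫⁻ y, ENNReal.ofReal ‖y‖
    ∂(volume.withDensity fun y => ENNReal.ofReal (f y))).toReal, ?_⟩
  filter_upwards [Filter.eventually_gt_atTop 0] with N hN
  have hN' : (1 : ℝ) ≤ N := by exact_mod_cast hN
  refine (measure_exists_norm_ge_le _ (by positivity) N).trans ?_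
  set I := ∫⁻ y, ENNReal.ofReal ‖y‖ ∂(volume.withDensity fun y => ENNReal.ofReal (f y))
  rw [← ENNReal.ofReal_toReal hfin, ← ENNReal.ofReal_div_of_pos (by positivity),
    ← ENNReal.ofReal_natCast, ← ENNReal.ofReal_mul (Nat.cast_nonneg N),
    ENNReal.toReal_ofReal ENNReal.toReal_nonneg]
  refine ENNReal.ofReal_le_ofReal ?_
  have hI : 0 ≤ I.toReal := ENNReal.toReal_nonneg
  calc (N : ℝ) * (I.toReal / N ^ 3) = I.toReal / (N * N) := by field_simp
    _ ≤ I.toReal / (N * 1) := by gcongr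
    _ = _ := by rw [mul_one]

/-- Logarithmically many shells would do; a multiple of `N^(1/40)` is already of lower order. The
factor `2` in the exponent gives `2 ^ (2y) ≥ exp y`, since `log 2 > 1/2`. -/
theorem eventually_countScale_pow_lt {ρ : ℝ} (hρ : 0 < ρ) :
    ∀ᶠ N : ℕ in Filter.atTop, 2 * (N : ℝ) ^ 3 ≤ 2 ^ ⌈2 * countScale N⌉₊ * ρ := by
  have h2 := ((Real.tendsto_pow_mul_exp_neg_atTop_nhds_zero 120).comp
    tendsto_countScale).eventually (eventually_le_nhds (show (0 : ℝ) < ρ / 2 by positivity))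
  filter_upwards [h2] with N hN
  simp only [Function.comp] at hN
  have h3 : Real.exp (countScale N) ≤ 2 ^ ⌈2 * countScale N⌉₊ := by
    have e : (2 : ℝ) ^ ⌈2 * countScale N⌉₊ = Real.exp (⌈2 * countScale N⌉₊ * Real.log 2) := by
      rw [Real.exp_nat_mul, Real.exp_log zero_lt_two]
    rw [e]
    refine Real.exp_le_exp.2 ?_
    have := Nat.le_ceil (2 * countScale N)
    have := Real.log_two_gt_d9
    have : (0 : ℝ) ≤ ⌈2 * countScale N⌉₊ := Nat.cast_nonneg _
    nlinarith
  rw [Real.exp_neg, ← div_eq_mul_inv, div_le_iff₀ (Real.exp_pos _)] at hN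
  calc 2 * (N : ℝ) ^ 3 = 2 * countScale N ^ 120 := by rw [natCast_eq_countScale_pow N]; ring
    _ ≤ 2 * (ρ / 2 * Real.exp (countScale N)) := by gcongr
    _ = Real.exp (countScale N) * ρ := by ring
    _ ≤ _ := by gcongr

theorem exists_mem_of_lt_card {N : ℕ} {p : Fin N → Prop} [DecidablePred p] {a : ℝ} (ha : 0 < a)
    (h : a ≤ ((Finset.univ.filter p).card : ℝ)) : ∃ i, p i := by
  have : 0 < (Finset.univ.filter p).card := by exact_mod_cast ha.trans_le h
  obtain ⟨i, hi⟩ := Finset.card_pos.1 this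
  exact ⟨i, (Finset.mem_filter.1 hi).2⟩

/-- Outside of a negligible event, the mean number of computed elements over all orders is at most
`(3 V δ₁ + 12 (4 / α) ^ d) N ^ (1 / 2)` up to a lower order term. -/
theorem exists_negligible_sum_numComputed_le {d : ℕ} (hd : 0 < d)
    {f : EuclideanSpace ℝ (Fin d) → ℝ} (hf : Measurable f)
    [IsProbabilityMeasure (volume.withDensity fun y => ENNReal.ofReal (f y))]
    (hint : Integrable fun y => ‖y‖ * f y)
    (m : (N : ℕ) → [NeZero N] → (Fin N → EuclideanSpace ℝ (Fin d)) → Fin N)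
    (hm : ∀ (N : ℕ) [NeZero N] (x : Fin N → EuclideanSpace ℝ (Fin d)), IsMedoid x (m N x))
    {ρ δ₀ δ₁ α : ℝ} (hρ : 0 < ρ) (hδ₀ : 0 < δ₀) (hδ₁ : 0 < δ₁) (hα : 0 < α)
    (hρα : α * ρ * d ≤ 4)
    (hdens : Negligible f fun N => {x | ∃ _ : NeZero N,
      ¬ ∀ y ∈ Metric.closedBall (x (m N x)) ρ, δ₀ ≤ f y ∧ f y ≤ δ₁})
    (hgrowth : Negligible f fun N => {x | ∃ _ : NeZero N,
      ¬ ∀ i : Fin N, x i ∈ Metric.closedBall (x (m N x)) ρ →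
          (N : ℝ) ^ (-(1 / (2 * (d : ℝ)))) ≤ ‖x i - x (m N x)‖ →
          α * ‖x i - x (m N x)‖ ^ 2 ≤ energy x i - energy x (m N x)}) :
    ∃ B, Negligible f B ∧ ∃ D : ℝ, ∀ᶠ N : ℕ in Filter.atTop, ∀ x ∉ B N,
      ∑ σ : Equiv.Perm (Fin N), (numComputed x σ : ℝ) ≤ N.factorial *
        ((3 * (unitBallVolume d * δ₁) + 12 * (4 / α) ^ d) * countScale N ^ 20 +
          D * countScale N ^ 19) := by
  have hV := unitBallVolume_pos d
  have hd' : (0 : ℝ) < d := by exact_mod_cast hd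
  set A : ℝ := unitBallVolume d * δ₁ with hA
  have hA0 : 0 < A := by positivity
  -- Chosen so that the slope `d (6 A + 4) z ^ 8` over the distance `b z ^ q` gives exactly the
  -- allowance `α / (2 d) * z ^ (q + 8)`.
  set b : ℝ := α / (2 * d) / (d * (6 * A + 4)) with hb
  have hb0 : 0 < b := by positivity
  set c : ℝ := δ₀ * unitBallVolume d * b ^ d / 8 with hc
  have hc0 : 0 < c := by positivity
  set κ : ℝ := min (ρ / 4) (α * ρ ^ 2 / 32) with hκ
  have hκ0 : 0 < κ := by positivity
  have hκ1 : κ ≤ ρ / 4 := min_le_left _ _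
  -- A `κ / 2`-net whose size does not depend on `N`: a sample point within `κ / 2` of each
  -- translated net point gives density `κ` on the whole sphere.
  obtain ⟨T, hTs, hTfin, hTcov⟩ := (isCompact_sphere (0 : EuclideanSpace ℝ (Fin d))
    (ρ / 2)).finite_cover_balls (e := κ / 2) (by positivity)
  have hz := tendsto_lengthScale hd
  have hsmall : ∀ ε : ℝ, 0 < ε → ∀ᶠ N : ℕ in Filter.atTop, lengthScale d N ≤ ε :=
    fun ε hε => hz.eventually (eventually_le_nhds hε)
  have hpow : ∀ {N : ℕ}, 0 < N → ∀ {q : ℕ}, q ≠ 0 → lengthScale d N ^ q ≤ lengthScale d N :=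
    fun hN _ hq => pow_le_of_le_one (lengthScale_pos d hN).le (lengthScale_le_one d hN) hq
  have hup := Negligible.biUnion ({20, 13, 8} : Finset ℕ) fun q hq =>
    negligible_card_gt (ρ := ρ) hd (f := f) (q := q) hδ₁ hρ (by rintro rfl; simp at hq)
      (by simp at hq; omega)
  have hlow := Negligible.biUnion ({32, 18} : Finset ℕ) fun q hq =>
    negligible_card_lt (ρ := ρ) hd hf (q := q) hδ₀ hb0 (by simp at hq; omega) (fun _ => 0) (by
      filter_upwards [hsmall (ρ / b) (by positivity), Filter.eventually_gt_atTop 0] with N h1 h2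
      have hq0 : q ≠ 0 := by rintro rfl; simp at hq
      rw [norm_zero, zero_add, mul_comm]
      exact (le_div_iff₀ hb0).1 ((hpow h2 hq0).trans h1))
  have haxes := Negligible.biUnion (Finset.univ ×ˢ {1, -1} : Finset (Fin d × ℝ)) fun p hp =>
    negligible_card_lt (ρ := ρ) hd hf (q := 24) hδ₀ zero_lt_one (by norm_num)
      (fun N => EuclideanSpace.single p.1 (p.2 * lengthScale d N ^ 16)) (by
      filter_upwards [hsmall (ρ / 2) (by positivity), Filter.eventually_gt_atTop 0] with N h1 h2
      have hp2 : |p.2| = 1 := by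
        simp only [Finset.mem_product, Finset.mem_univ, true_and, Finset.mem_insert,
          Finset.mem_singleton] at hp
        rcases hp with h | h <;> simp [h]
      have hz0 := lengthScale_pos d h2
      rw [PiLp.norm_single, Real.norm_eq_abs, abs_mul, hp2,
        abs_of_pos (by positivity)]
      linarith [hpow h2 (q := 16) (by norm_num), hpow h2 (q := 24) (by norm_num)])
  have hnet := Negligible.biUnion hTfin.toFinset fun t ht =>
    negligible_card_lt (ρ := ρ) hd hf (q := 0) (b := κ / 2) hδ₀ (by positivity) (by norm_num)
      (fun _ => t) (by
      filter_upwards with N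
      have := hTs (hTfin.mem_toFinset.1 ht)
      rw [mem_sphere_zero_iff_norm] at this
      simp only [this, pow_zero, mul_one]
      linarith)
  refine ⟨_, hdens.union (hgrowth.union (hup.union (hlow.union (haxes.union (hnet.union
    (negligible_norm_ge hf hint)))))),
    1 + 3 * (1 + 8 / (α * ρ / 16)) ^ d + (3 * A + 1) / c + 1 / c, ?_⟩
  filter_upwards [hsmall (ρ / 4) (by positivity), hsmall (1 / (b * d)) (by positivity),
    hsmall (α * ρ / 16 * ρ / 2 / (α / (2 * d))) (by positivity), eventually_countScale_pow_lt hρ,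
    Filter.eventually_gt_atTop 0] with N hN1 hN2 hN3 hN4 hN0 x hx
  have : NeZero N := ⟨hN0.ne'⟩
  set y := countScale N with hy
  set z := lengthScale d N with hzdef
  have hy1 : 1 ≤ y := one_le_countScale hN0
  have hz0 : 0 < z := lengthScale_pos d hN0
  simp only [Set.mem_union, not_or] at hx
  obtain ⟨hx1, hx2, hx3, hx4, hx5, hx6, hx7⟩ := hx
  have g1 : ∀ y ∈ Metric.closedBall (x (m N x)) ρ, δ₀ ≤ f y ∧ f y ≤ δ₁ := by
    by_contra h
    exact hx1 ⟨this, h⟩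
  have g2 : ∀ i : Fin N, dist (x i) (x (m N x)) ≤ ρ → z ^ 20 ≤ dist (x i) (x (m N x)) →
      α * dist (x i) (x (m N x)) ^ 2 ≤ energy x i - energy x (m N x) := by
    by_contra h
    refine hx2 ⟨this, fun h' => h fun i hi1 hi2 => ?_⟩
    rw [hzdef, lengthScale_pow_twenty hd, dist_eq_norm] at hi2
    rw [dist_eq_norm]
    exact h' i hi1 hi2
  have g3 : ∀ q ∈ ({20, 13, 8} : Finset ℕ),
      ((Finset.univ.filter fun i => dist (x i) (x (m N x)) ≤ z ^ q).card : ℝ) ≤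
        3 * N * (A * (z ^ q) ^ d) + 1 := by
    intro q hq
    by_contra! h
    -- The excluded event allows any centre, in particular the medoid, whose index depends on the
    -- sample.
    exact hx3 (Set.mem_biUnion hq ⟨m N x, fun y hy => (g1 y hy).2, h⟩)
  have g4 : ∀ q ∈ ({32, 18} : Finset ℕ), c * (N * (z ^ q) ^ d) ≤
      ((Finset.univ.filter fun i => dist (x i) (x (m N x)) ≤ b * z ^ q).card : ℝ) := by
    intro q hq
    by_contra! h
    refine hx4 (Set.mem_biUnion hq ⟨m N x, fun y hy => (g1 y hy).1, ?_⟩)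
    simpa only [add_zero] using h
  have g5 : ∀ k, ∀ e : ℝ, |e| = z ^ 16 →
      ∃ i, dist (x i) (x (m N x) + EuclideanSpace.single k e) ≤ z ^ 24 := by
    intro k e he
    obtain ⟨s, hs, rfl⟩ : ∃ s : ℝ, s ∈ ({1, -1} : Finset ℝ) ∧ e = s * z ^ 16 := by
      rcases abs_eq (by positivity) |>.1 he with h | h
      · exact ⟨1, by simp, by rw [h, one_mul]⟩
      · exact ⟨-1, by simp, by rw [h, neg_one_mul]⟩
    by_contra! h
    refine hx5 (Set.mem_biUnion (x := (k, s)) (by simpa using hs)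
      ⟨m N x, fun y hy => (g1 y hy).1, ?_⟩)
    by_contra! h'
    obtain ⟨i, hi⟩ := exists_mem_of_lt_card (by positivity) h'
    rw [one_mul] at hi
    exact absurd hi (h i).not_ge
  have g6 : ∀ u : EuclideanSpace ℝ (Fin d), ‖u‖ = ρ / 2 →
      ∃ k, dist (x k) (x (m N x) + u) ≤ κ := by
    intro u hu
    obtain ⟨t, ht, htu⟩ := Set.mem_iUnion₂.1 (hTcov (mem_sphere_zero_iff_norm.2 hu))
    by_contra! h
    refine hx6 (Set.mem_biUnion (hTfin.mem_toFinset.2 ht)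
      ⟨m N x, fun y hy => (g1 y hy).1, ?_⟩)
    by_contra! h'
    obtain ⟨i, hi⟩ := exists_mem_of_lt_card (by positivity) h'
    rw [pow_zero, mul_one] at hi
    have h2 := dist_triangle (x i) (x (m N x) + t) (x (m N x) + u)
    rw [dist_add_left, dist_comm t u] at h2
    linarith [h i, Metric.mem_ball.1 htu]
  have g7 : ∀ i, dist (x i) (x (m N x)) < 2 ^ ⌈2 * y⌉₊ * ρ := by
    intro i
    have h : ∀ j, ‖x j‖ < (N : ℝ) ^ 3 := fun j => by
      by_contra! h
      exact hx7 ⟨j, h⟩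
    linarith [dist_le_norm_add_norm (x i) (x (m N x)), h i, h (m N x)]
  have hmain := sum_numComputed_le_of_good hd x (m N x) (hm N x) (y := y) (z := z) (A := A)
    (b := b) (c := c) hz0 (lengthScale_le_one d hN0) hA0.le hα hρ hc0
    (natCast_eq_countScale_pow N) (countScale_mul_lengthScale_pow hd hN0) hρα hκ1
    (min_le_right _ _) (by rw [hb]; field_simp) hN1
    ((le_div_iff₀ (by positivity)).1 hN2) (by rw [mul_comm]; exact (le_div_iff₀ (by positivity)).1 hN3)
    _ g7 g2 g3 g4 g5 g6
  refine hmain.trans (mul_le_mul_of_nonneg_left ?_ (Nat.cast_nonneg _))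
  set M : ℝ := (1 + 8 / (α * ρ / 16)) ^ d with hM
  have hM0 : 0 ≤ M := by positivity
  have hy19 : 1 ≤ y ^ 19 := one_le_pow₀ hy1
  have hK : (⌈2 * y⌉₊ : ℝ) ≤ 3 * y ^ 19 := by
    have h1 := Nat.ceil_lt_add_one (show 0 ≤ 2 * y by positivity)
    have h2 : y ≤ y ^ 19 := le_self_pow₀ hy1 (by norm_num)
    linarith
  have e1 : (3 * A * y ^ 27 + 1) / (c * y ^ 8) ≤ (3 * A + 1) / c * y ^ 19 := by
    rw [div_le_iff₀ (by positivity)]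
    calc 3 * A * y ^ 27 + 1 ≤ 3 * A * y ^ 27 + y ^ 27 := by
          linarith [one_le_pow₀ hy1 (n := 27)]
      _ = (3 * A + 1) / c * y ^ 19 * (c * y ^ 8) := by field_simp
  have e2 : y ^ 40 / (c * y ^ 22) ≤ 1 / c * y ^ 19 := by
    rw [div_le_iff₀ (by positivity)]
    calc y ^ 40 ≤ y ^ 41 := pow_le_pow_right₀ hy1 (by norm_num)
      _ = 1 / c * y ^ 19 * (c * y ^ 22) := by field_simp
  have e3 : (⌈2 * y⌉₊ : ℝ) * M ≤ 3 * y ^ 19 * M := by gcongr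
  linarith

/-! ### Expectations -/

theorem expectedValue_le_of_negligible {d : ℕ} {f : EuclideanSpace ℝ (Fin d) → ℝ}
    [IsProbabilityMeasure (volume.withDensity fun y => ENNReal.ofReal (f y))]
    {B : (N : ℕ) → Set (Fin N → EuclideanSpace ℝ (Fin d))} (hB : Negligible f B) {b : ℕ → ℝ}
    (hb : ∀ᶠ N : ℕ in Filter.atTop, 0 ≤ b N ∧ ∀ x ∉ B N,
      ∑ σ : Equiv.Perm (Fin N), (numComputed x σ : ℝ) ≤ N.factorial * b N) :
    ∃ K : ℝ, ∀ᶠ N : ℕ in Filter.atTop,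
      expectedValue f N numComputed ≤ ENNReal.ofReal (b N + K) := by
  obtain ⟨K, hK⟩ := hB
  refine ⟨max K 0, ?_⟩
  filter_upwards [hb, hK, Filter.eventually_gt_atTop 0] with N ⟨hb0, hbN⟩ hKN hN
  have hN' : (0 : ℝ) < N := by exact_mod_cast hN
  have hprob : IsProbabilityMeasure (sampleLaw f N) := by unfold sampleLaw; infer_instance
  have hfact : (0 : ℝ) < N.factorial := by exact_mod_cast N.factorial_pos
  have hsum : ∀ x : Fin N → EuclideanSpace ℝ (Fin d),
      (∑ σ, (numComputed x σ : ℝ≥0∞)) / (Fintype.card (Equiv.Perm (Fin N)) : ℝ≥0∞) =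
      ENNReal.ofReal ((∑ σ, (numComputed x σ : ℝ)) / N.factorial) := by
    intro x
    rw [ENNReal.ofReal_div_of_pos hfact, ENNReal.ofReal_sum_of_nonneg fun _ _ => Nat.cast_nonneg _,
      Fintype.card_perm, Fintype.card_fin]
    simp
  unfold expectedValue
  simp_rw [hsum]
  -- The exceptional event need not be measurable, so it is replaced by a measurable hull of the
  -- same measure.
  set S := toMeasurable (sampleLaw f N) (B N)
  have hS : MeasurableSet S := measurableSet_toMeasurable _ _
  calc _ ≤ ∫⁻ x, (ENNReal.ofReal (b N) + S.indicator (fun _ => ENNReal.ofReal N) x)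
        ∂(sampleLaw f N) := by
        refine lintegral_mono fun x => ?_
        by_cases hx : x ∈ B N
        · rw [Set.indicator_of_mem (subset_toMeasurable _ _ hx)]
          refine le_add_left (ENNReal.ofReal_le_ofReal ?_)
          rw [div_le_iff₀ hfact]
          calc ∑ σ, (numComputed x σ : ℝ) ≤ ∑ _σ : Equiv.Perm (Fin N), (N : ℝ) :=
                Finset.sum_le_sum fun σ _ => by exact_mod_cast numComputed_le x σ
            _ = N * N.factorial := by simp [Fintype.card_perm, mul_comm]
        · refine le_add_right (ENNReal.ofReal_le_ofReal ?_)
          rw [div_le_iff₀ hfact, mul_comm]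
          exact hbN x hx
    _ = ENNReal.ofReal (b N) + ENNReal.ofReal N * sampleLaw f N (B N) := by
        rw [lintegral_add_left measurable_const, lintegral_const, measure_univ, mul_one,
          lintegral_indicator_const hS, measure_toMeasurable]
    _ ≤ ENNReal.ofReal (b N) + ENNReal.ofReal N * ENNReal.ofReal (max K 0 / N) := by
        gcongr
        refine hKN.trans (ENNReal.ofReal_le_ofReal ?_)
        gcongr
        exact le_max_left _ _
    _ = _ := by
        rw [← ENNReal.ofReal_mul hN'.le, mul_div_cancel₀ _ hN'.ne',
          ← ENNReal.ofReal_add hb0 (le_max_right _ _)]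

theorem expectedValue_runTime_le {d : ℕ} {f : EuclideanSpace ℝ (Fin d) → ℝ}
    [IsProbabilityMeasure (volume.withDensity fun y => ENNReal.ofReal (f y))] (N : ℕ) :
    expectedValue f N runTime ≤
      (3 * N + 5 : ℕ) + expectedValue f N numComputed * (7 * N + 4 : ℕ) := by
  have hprob : IsProbabilityMeasure (sampleLaw f N) := by unfold sampleLaw; infer_instance
  set F : ℝ≥0∞ := (Fintype.card (Equiv.Perm (Fin N)) : ℝ≥0∞) with hF
  have hF0 : F ≠ 0 := by simp [hF]
  have hFtop : F ≠ ⊤ := ENNReal.natCast_ne_top _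
  unfold expectedValue
  rw [← lintegral_mul_const' _ _ (ENNReal.natCast_ne_top _)]
  calc _ ≤ ∫⁻ x, (((3 * N + 5 : ℕ) : ℝ≥0∞) +
        (∑ σ, (numComputed x σ : ℝ≥0∞)) / F * (7 * N + 4 : ℕ)) ∂(sampleLaw f N) := by
        refine lintegral_mono fun x => ?_
        calc (∑ σ, (runTime x σ : ℝ≥0∞)) / F
            ≤ (∑ σ, (((3 * N + 5 : ℕ) : ℝ≥0∞) + numComputed x σ * (7 * N + 4 : ℕ))) / F := by
              gcongr with σ
              exact_mod_cast runTime_le x σ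
          _ = _ := by
              rw [Finset.sum_add_distrib, ← Finset.sum_mul, ENNReal.add_div, Finset.sum_const,
                nsmul_eq_mul, Finset.card_univ, ← hF, mul_comm F, ENNReal.mul_div_cancel_right hF0
                hFtop, ENNReal.mul_div_right_comm]
    _ = _ := by rw [lintegral_add_left measurable_const, lintegral_const, measure_univ, mul_one]

theorem theorem2 :
    -- one constant, independent of the dimension, the density and all parameters
    ∃ C : ℝ, 0 < C ∧
    ∀ (d : ℕ), 0 < d →
    -- a probability density on `ℝ^d` with finite mean distance
    ∀ (f : EuclideanSpace ℝ (Fin d) → ℝ), Measurable f → (∀ y, 0 ≤ f y) →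
      ∫⁻ y, ENNReal.ofReal (f y) = 1 →
      Integrable (fun y => ‖y‖ * f y) →
    -- any choice of the medoid of every set (if several elements have the least energy)
    ∀ (m : (N : ℕ) → [NeZero N] → (Fin N → EuclideanSpace ℝ (Fin d)) → Fin N),
      (∀ (N : ℕ) [NeZero N] (x : Fin N → EuclideanSpace ℝ (Fin d)), IsMedoid x (m N x)) →
    ∀ (ρ δ₀ δ₁ α : ℝ), 0 < ρ → 0 < δ₀ → 0 < δ₁ → 0 < α →
    -- with probability `1 - O(1/N)`, the density is bounded near the medoid
    (∃ K : ℝ, ∀ (N : ℕ) [NeZero N],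
      sampleLaw f N {x | ¬ ∀ y ∈ Metric.closedBall (x (m N x)) ρ, δ₀ ≤ f y ∧ f y ≤ δ₁}
        ≤ ENNReal.ofReal (K / N)) →
    -- with probability `1 - O(1/N)`, the energy grows quadratically near the medoid,
    -- from the distance `N ^ (-1 / (2 * d))` on
    (∃ K : ℝ, ∀ (N : ℕ) [NeZero N],
      sampleLaw f N {x | ¬ ∀ i : Fin N, x i ∈ Metric.closedBall (x (m N x)) ρ →
          (N : ℝ) ^ (-(1 / (2 * (d : ℝ)))) ≤ ‖x i - x (m N x)‖ →
          α * ‖x i - x (m N x)‖ ^ 2 ≤ energy x i - energy x (m N x)}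
        ≤ ENNReal.ofReal (K / N)) →
    ∃ N₀ : ℕ, ∀ N : ℕ, N₀ ≤ N →
      expectedValue f N numComputed ≤
          ENNReal.ofReal (C * (unitBallVolume d * δ₁ + d * (4 / α) ^ d) * (N : ℝ) ^ (1 / 2 : ℝ)) ∧
      expectedValue f N runTime ≤
          ENNReal.ofReal (C * (unitBallVolume d * δ₁ + d * (4 / α) ^ d) * (N : ℝ) ^ (3 / 2 : ℝ)) := by
  -- `13` suffices for the count: `3 A + 12 G` plus one `A` for the lower order terms. A computed
  -- element costs at most `7 N + 4 ≤ 11 N` steps, and `144 = 13 * 11 + 1` leaves `1` for the steps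
  -- outside of the computations.
  refine ⟨144, by norm_num, ?_⟩
  intro d hd f hf _ hf1 hint m hm ρ₀ δ₀ δ₁ α hρ₀ hδ₀ hδ₁ hα hdens hgrowth
  have hprob : IsProbabilityMeasure (volume.withDensity fun y => ENNReal.ofReal (f y)) :=
    ⟨by rw [withDensity_apply _ MeasurableSet.univ, Measure.restrict_univ, hf1]⟩
  have hd' : (1 : ℝ) ≤ d := by exact_mod_cast hd
  -- Both hypotheses pass to smaller balls, so `ρ` may be shrunk until `α ρ d ≤ 4`, as the packing
  -- estimate requires.
  set ρ : ℝ := min ρ₀ (4 / (α * d)) with hρ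
  have hρ0 : 0 < ρ := by positivity
  have hρα : α * ρ * d ≤ 4 := by
    have h : ρ ≤ 4 / (α * d) := min_le_right _ _
    rw [le_div_iff₀ (by positivity)] at h
    linarith
  -- An empty sample has no medoid; the existential makes the event meaningful, and empty, for `N =
  -- 0`.
  have hdens' : Negligible f fun N => {x | ∃ _ : NeZero N,
      ¬ ∀ y ∈ Metric.closedBall (x (m N x)) ρ, δ₀ ≤ f y ∧ f y ≤ δ₁} := by
    obtain ⟨K, hK⟩ := hdens
    refine ⟨K, ?_⟩
    filter_upwards [Filter.eventually_gt_atTop 0] with N hN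
    have : NeZero N := ⟨hN.ne'⟩
    refine (measure_mono ?_).trans (hK N)
    rintro x ⟨_, hx⟩ h
    exact hx fun y hy => h y (Metric.closedBall_subset_closedBall (min_le_left _ _) hy)
  have hgrowth' : Negligible f fun N => {x | ∃ _ : NeZero N,
      ¬ ∀ i : Fin N, x i ∈ Metric.closedBall (x (m N x)) ρ →
          (N : ℝ) ^ (-(1 / (2 * (d : ℝ)))) ≤ ‖x i - x (m N x)‖ →
          α * ‖x i - x (m N x)‖ ^ 2 ≤ energy x i - energy x (m N x)} := by
    obtain ⟨K, hK⟩ := hgrowth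
    refine ⟨K, ?_⟩
    filter_upwards [Filter.eventually_gt_atTop 0] with N hN
    have : NeZero N := ⟨hN.ne'⟩
    refine (measure_mono ?_).trans (hK N)
    rintro x ⟨_, hx⟩ h
    exact hx fun i hi => h i (Metric.closedBall_subset_closedBall (min_le_left _ _) hi)
  have hV := unitBallVolume_pos d
  obtain ⟨B, hB, D, hD⟩ := exists_negligible_sum_numComputed_le hd hf hint m hm hρ0 hδ₀ hδ₁ hα hρα
    hdens' hgrowth'
  set A : ℝ := unitBallVolume d * δ₁ with hA
  set G : ℝ := (4 / α) ^ d with hG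
  have hA0 : 0 < A := by positivity
  have hG0 : 0 < G := by positivity
  -- The factor `d` of the claimed bound enters only here; the estimates above do without it.
  have hW : A + G ≤ A + d * G := by nlinarith
  obtain ⟨K, hK⟩ := expectedValue_le_of_negligible hB
    (b := fun N => (3 * A + 12 * G) * countScale N ^ 20 + max D 0 * countScale N ^ 19) (by
      filter_upwards [hD, Filter.eventually_gt_atTop 0] with N hN hN0
      have hy := countScale_pos hN0
      refine ⟨by positivity, fun x hx => (hN x hx).trans ?_⟩
      gcongr
      exact le_max_left _ _)
  refine Filter.eventually_atTop.1 ?_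
  filter_upwards [hK, tendsto_countScale.eventually_ge_atTop ((max D 0 + |K|) / A),
    tendsto_countScale.eventually_ge_atTop (8 / A), Filter.eventually_gt_atTop 0]
    with N hKN hy1 hy2 hN
  set y := countScale N with hy
  have hy0 : 1 ≤ y := one_le_countScale hN
  have hNy : (N : ℝ) = y ^ 40 := natCast_eq_countScale_pow N
  have e1 : (N : ℝ) ^ (1 / 2 : ℝ) = y ^ 20 := by rw [hy, countScale_pow]; norm_num
  have e2 : (N : ℝ) ^ (3 / 2 : ℝ) = y ^ 60 := by rw [hy, countScale_pow]; norm_num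
  rw [div_le_iff₀ hA0] at hy1 hy2
  have hcomp : expectedValue f N numComputed ≤ ENNReal.ofReal (13 * (A + d * G) * y ^ 20) := by
    refine hKN.trans (ENNReal.ofReal_le_ofReal ?_)
    have h1 : 1 ≤ y ^ 19 := one_le_pow₀ hy0
    have h2 : K ≤ |K| * y ^ 19 := (le_abs_self K).trans (le_mul_of_one_le_right (abs_nonneg K) h1)
    have h3 : (max D 0 + |K|) * y ^ 19 ≤ y * A * y ^ 19 := by gcongr
    have h4 : (A + G) * y ^ 20 ≤ (A + d * G) * y ^ 20 := by gcongr
    have h5 : y * A * y ^ 19 = A * y ^ 20 := by ring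
    have h6 : 0 ≤ A * y ^ 20 := by positivity
    have h7 : 0 ≤ G * y ^ 20 := by positivity
    linarith
  refine ⟨hcomp.trans (ENNReal.ofReal_le_ofReal ?_), ?_⟩
  · rw [e1]
    gcongr
    norm_num
  · refine (expectedValue_runTime_le N).trans ((add_le_add_right (mul_le_mul_left hcomp _) _).trans ?_)
    rw [← ENNReal.ofReal_natCast, ← ENNReal.ofReal_natCast, ← ENNReal.ofReal_mul (by positivity),
      ← ENNReal.ofReal_add (by positivity) (by positivity)]
    refine ENNReal.ofReal_le_ofReal ?_
    rw [e2]
    push_cast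
    rw [hNy]
    set W : ℝ := A + d * G with hWdef
    have hW0 : 0 < W := by positivity
    have h40 : 1 ≤ y ^ 40 := one_le_pow₀ hy0
    have h8 : 8 ≤ W * y ^ 20 := by
      have h1 : y ≤ y ^ 20 := le_self_pow₀ hy0 (by norm_num)
      calc (8 : ℝ) ≤ y * A := hy2
        _ ≤ y ^ 20 * W := by gcongr; linarith
        _ = _ := by ring
    have h9 : 8 * y ^ 40 ≤ W * y ^ 20 * y ^ 40 := by gcongr
    have h10 : 13 * W * y ^ 20 * (7 * y ^ 40 + 4) ≤ 13 * W * y ^ 20 * (11 * y ^ 40) := by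
      gcongr; linarith
    calc 3 * y ^ 40 + 5 + 13 * W * y ^ 20 * (7 * y ^ 40 + 4)
        ≤ 8 * y ^ 40 + 13 * W * y ^ 20 * (11 * y ^ 40) := by linarith
      _ ≤ W * y ^ 20 * y ^ 40 + 13 * W * y ^ 20 * (11 * y ^ 40) := by linarith
      _ = 144 * W * y ^ 60 := by ring
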